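/- Let $H_3$ be the Heisenberg group, i.e. $\mathbb R^3$ with the product $$(a,b,c)(x,y,z)=\bigl(a+x,\;b+y,\;c+z+\tfrac12(ay-bx)\bigr),$$ equipped with the left-invariant Riemannian metric $g$ for which the standard basis $e_1,e_2,e_3$ of $\mathfrak h_3=T_eH_3$ is orthonormal. A Lorentz force on $H_3$ is a smooth $(1,1)$-tensor $F$, skew-symmetric with respect to $g$, whose associated $2$-form $g(F\cdot,\cdot)$ is closed. Let $\mathrm{Iso}(H_3)$ be the isometry group of $(H_3,g)$, and let the group $\mathrm{Iso}(H_3)\times\mathbb R^*$ act on Lorentz forces by $(\psi,r)\cdot F=r\,\psi_*\circ F\circ\psi_*^{-1}$. For $U=\beta e_1+\alpha e_2$ and $\rho\in\mathbb R$, let $F_{U,\rho}$ be the left-invariant Lorentz force whose value at the identity has, in the basis $e_1,e_2,e_3$, the matrix $$\begin{pmatrix}0&-\rho&-\beta\\ \rho&0&-\alpha\\ \beta&\alpha&0\end{pmatrix}.$$ The group $\mathrm O(2)$ acts on $H_3=\mathbb R^2\times\mathbb R$ by isometric automorphisms $B\cdot(V,Z)=(BV,\det(B)Z)$. Let $S\in\mathrm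 O(2)$ be given by $S(e_1)=e_1$, $S(e_2)=-e_2$, and let $\mathrm{SO}^-(2)$ be the set of $B\in\mathrm O(2)$ with $\det B=-1$. For a subgroup $K\le\mathrm O(2)\times\mathbb R^*$, the group $H_3\rtimes K$ (with $K$ acting on $H_3$ through its projection to $\mathrm O(2)$) is identified with a subgroup of $\mathrm{Iso}(H_3)\times\mathbb R^*$ by the injective homomorphism $(a,(B,r))\mapsto(L_a\circ B,\,r)$, where $L_a$ denotes left translation by $a$. Then $\mathrm{Iso}(H_3)\times\mathbb R^*$ acts on the set of nonzero left-invariant Lorentz forces. The forces $$F_{e_1,\rho}\quad(\rho\ge 0)\qquad\text{and}\qquad F_{0,1}$$ belong to this set, they lie in pairwise distinct orbits, and every orbit in this set contains exactly one of them. The isotropy subgroups in $\mathrm{Iso}(H_3)\times\mathbb R^*$ are: 1. for $F_{e_1,\rho}$ with $\rho>0$: $H_3\rtimes\{(\mathrm{Id},1),(S,-1)\}$; 2. for $F_{e_1,0}$: $H_3\rtimes\{(\mathrm{Id},1),(-S,1),(-\mathrm{Id},-1),(S,-1)\}$; 3. for $F_{0,1}$: $H_3\rtimes\bigl(\mathrm{SO}(2)\times\{1\}\;\cup\;\mathrm{SO}^-(2)\times\{-1\}\bigr)$.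 -/

import Mathlib

open scoped ContDiff

noncomputable section

/-! ### The Heisenberg group and its canonical left-invariant metric -/

/-- The Heisenberg group `H₃`, modelled on `ℝ³` with coordinates `(x, y, z) = (p 0, p 1, p 2)`.
As a normed space it is the coordinate space `ℝ³`; every tangent space is identified with it
through the coordinates. The group law is the multiplication below. -/
def H3 : Type := Fin 3 → ℝ

namespace H3

instance instNACG : NormedAddCommGroup H3 := inferInstanceAs (NormedAddCommGroup (Fin 3 → ℝ))

instance instNS : NormedSpace ℝ H3 := inferInstanceAs (NormedSpace ℝ (Fin 3 → ℝ))

instance instFD : FiniteDimensional ℝ H3 := inferInstanceAs (FiniteDimensional ℝ (Fin 3 → ℝ))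

/-- The point with coordinates `(x, y, z)`. -/
def mk (x y z : ℝ) : H3 := ![x, y, z]

@[simp] theorem mk_zero (x y z : ℝ) : mk x y z 0 = x := rfl

@[simp] theorem mk_one (x y z : ℝ) : mk x y z 1 = y := rfl

@[simp] theorem mk_two (x y z : ℝ) : mk x y z 2 = z := rfl

@[simp] theorem add_coord (u v : H3) (i : Fin 3) : (u + v) i = u i + v i := rfl

@[simp] theorem smul_coord (c : ℝ) (u : H3) (i : Fin 3) : (c • u) i = c * u i := rfl

theorem ext3 {p q : H3} (h0 : p 0 = q 0) (h1 : p 1 = q 1) (h2 : p 2 = q 2) : p = q := by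
  funext i
  fin_cases i
  · exact h0
  · exact h1
  · exact h2

/-- `(a, b, c) (x, y, z) = (a + x, b + y, c + z + (a y - b x) / 2)`. -/
instance instGroup : Group H3 where
  mul p q := mk (p 0 + q 0) (p 1 + q 1) (p 2 + q 2 + (p 0 * q 1 - p 1 * q 0) / 2)
  one := mk 0 0 0
  inv p := mk (-p 0) (-p 1) (-p 2)
  mul_assoc p q r := by
    apply ext3
    · exact add_assoc (p 0) (q 0) (r 0)
    · exact add_assoc (p 1) (q 1) (r 1)
    · change p 2 + q 2 + (p 0 * q 1 - p 1 * q 0) / 2 + r 2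
          + ((p 0 + q 0) * r 1 - (p 1 + q 1) * r 0) / 2
        = p 2 + (q 2 + r 2 + (q 0 * r 1 - q 1 * r 0) / 2)
          + (p 0 * (q 1 + r 1) - p 1 * (q 0 + r 0)) / 2
      ring
  one_mul p := by
    apply ext3
    · exact zero_add (p 0)
    · exact zero_add (p 1)
    · change 0 + p 2 + (0 * p 1 - 0 * p 0) / 2 = p 2
      ring
  mul_one p := by
    apply ext3
    · exact add_zero (p 0)
    · exact add_zero (p 1)
    · change p 2 + 0 + (p 0 * 0 - p 1 * 0) / 2 = p 2
      ring
  inv_mul_cancel p := by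
    apply ext3
    · exact neg_add_cancel (p 0)
    · exact neg_add_cancel (p 1)
    · change -p 2 + p 2 + (-p 0 * p 1 - -p 1 * p 0) / 2 = 0
      ring

@[simp] theorem mul_zero_coord (p q : H3) : (p * q) 0 = p 0 + q 0 := rfl

@[simp] theorem mul_one_coord (p q : H3) : (p * q) 1 = p 1 + q 1 := rfl

@[simp] theorem mul_two_coord (p q : H3) :
    (p * q) 2 = p 2 + q 2 + (p 0 * q 1 - p 1 * q 0) / 2 := rfl

@[simp] theorem inv_zero_coord (p : H3) : p⁻¹ 0 = -p 0 := rfl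

@[simp] theorem inv_one_coord (p : H3) : p⁻¹ 1 = -p 1 := rfl

@[simp] theorem inv_two_coord (p : H3) : p⁻¹ 2 = -p 2 := rfl

@[simp] theorem one_coord (i : Fin 3) : (1 : H3) i = 0 := by
  fin_cases i <;> rfl

/-- The differential of the left translation `L_a : p ↦ a * p` in coordinates; it does not depend
on the base point, see `hasFDerivAt_mul_left`. -/
def dL (a : H3) : H3 →L[ℝ] H3 :=
  LinearMap.toContinuousLinearMap
    { toFun := fun u => mk (u 0) (u 1) (u 2 + (a 0 * u 1 - a 1 * u 0) / 2)
      map_add' := fun u v => by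
        apply ext3 <;> simp
        ring
      map_smul' := fun c u => by
        apply ext3 <;> simp
        ring }

theorem dL_apply (a u : H3) :
    dL a u = mk (u 0) (u 1) (u 2 + (a 0 * u 1 - a 1 * u 0) / 2) := rfl

theorem mul_eq_add_dL (a p : H3) : a * p = a + dL a p := by
  apply ext3 <;> simp [dL_apply]
  ring

theorem hasFDerivAt_mul_left (a p : H3) : HasFDerivAt (fun q : H3 => a * q) (dL a) p := by
  simp only [mul_eq_add_dL]
  exact (dL a).hasFDerivAt.const_add a

theorem dL_mul (a b u : H3) : dL (a * b) u = dL a (dL b u) := by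
  apply ext3 <;> simp [dL_apply]
  ring

theorem dL_one (u : H3) : dL 1 u = u := by
  apply ext3 <;> simp [dL_apply]

theorem dL_inv_dL (a u : H3) : dL a⁻¹ (dL a u) = u := by
  rw [← dL_mul, inv_mul_cancel, dL_one]

theorem dL_dL_inv (a u : H3) : dL a (dL a⁻¹ u) = u := by
  rw [← dL_mul, mul_inv_cancel, dL_one]

/-- The canonical Riemannian metric of `H₃`: the left-invariant metric for which the standard basis
`e₁, e₂, e₃` of the tangent space at the identity is orthonormal. Here `u, v` are tangent vectors
at `p`. -/
def metric (p u v : H3) : ℝ := ∑ i, dL p⁻¹ u i * dL p⁻¹ v i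

theorem metric_eq (p u v : H3) : metric p u v = u 0 * v 0 + u 1 * v 1
    + (u 2 + (p 1 * u 0 - p 0 * u 1) / 2) * (v 2 + (p 1 * v 0 - p 0 * v 1) / 2) := by
  simp [metric, Fin.sum_univ_three, dL_apply]
  ring

theorem metric_mul_left (a p u v : H3) :
    metric (a * p) (dL a u) (dL a v) = metric p u v := by
  simp only [metric, ← dL_mul, mul_inv_rev, inv_mul_cancel_right]

/-! ### The isometry group -/

/-- `Iso(H₃)`: the smooth diffeomorphisms of `H₃` whose differential preserves the metric. -/
def Iso : Subgroup (Equiv.Perm H3) where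
  carrier := {ψ | ContDiff ℝ ∞ ψ ∧ ContDiff ℝ ∞ ψ.symm ∧
    ∀ p u v, metric (ψ p) (fderiv ℝ ψ p u) (fderiv ℝ ψ p v) = metric p u v}
  one_mem' := by
    refine ⟨contDiff_id, contDiff_id, fun p u v => ?_⟩
    change metric p (fderiv ℝ id p u) (fderiv ℝ id p v) = _
    simp
  mul_mem' := by
    rintro φ ψ ⟨h1, h2, h3⟩ ⟨k1, k2, k3⟩
    refine ⟨h1.comp k1, k2.comp h2, fun p u v => ?_⟩
    have e : fderiv ℝ (φ ∘ ψ) p = (fderiv ℝ φ (ψ p)).comp (fderiv ℝ ψ p) :=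
      fderiv_comp p (h1.differentiable (by simp) _) (k1.differentiable (by simp) _)
    change metric (φ (ψ p)) (fderiv ℝ (φ ∘ ψ) p u) (fderiv ℝ (φ ∘ ψ) p v) = _
    rw [e]
    exact (h3 _ _ _).trans (k3 _ _ _)
  inv_mem' := by
    rintro ψ ⟨h1, h2, h3⟩
    refine ⟨h2, h1, fun p u v => ?_⟩
    have e : fderiv ℝ (ψ ∘ ψ.symm) p =
        (fderiv ℝ ψ (ψ.symm p)).comp (fderiv ℝ ψ.symm p) :=
      fderiv_comp p (h1.differentiable (by simp) _) (h2.differentiable (by simp) _)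
    have e' : ∀ w, fderiv ℝ ψ (ψ.symm p) (fderiv ℝ ψ.symm p w) = w := by
      intro w
      have : ψ ∘ ψ.symm = id := by
        funext q
        simp
      rw [this, fderiv_id] at e
      exact (congrArg (fun A : H3 →L[ℝ] H3 => A w) e).symm
    have := h3 (ψ.symm p) (fderiv ℝ ψ.symm p u) (fderiv ℝ ψ.symm p v)
    rw [e', e', Equiv.apply_symm_apply] at this
    exact this.symm

theorem Iso.fderiv_apply_symm (ψ : Iso) (p w : H3) :
    fderiv ℝ ψ.1 (ψ.1.symm p) (fderiv ℝ ψ.1.symm p w) = w := by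
  have e : fderiv ℝ (ψ.1 ∘ ψ.1.symm) p =
      (fderiv ℝ ψ.1 (ψ.1.symm p)).comp (fderiv ℝ ψ.1.symm p) :=
    fderiv_comp p (ψ.2.1.differentiable (by simp) _) (ψ.2.2.1.differentiable (by simp) _)
  have : (ψ.1 : H3 → H3) ∘ ψ.1.symm = id := by
    funext q
    simp
  rw [this, fderiv_id] at e
  exact (congrArg (fun A : H3 →L[ℝ] H3 => A w) e).symm

/-! ### Smoothness in coordinates -/

theorem contDiff_coord {f : H3 → H3} (hf : ContDiff ℝ ∞ f) (i : Fin 3) :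
    ContDiff ℝ ∞ (fun p => f p i) :=
  (ContinuousLinearMap.proj (R := ℝ) (φ := fun _ : Fin 3 => ℝ) i).contDiff.comp hf

theorem contDiff_of_coord {f : H3 → H3} (hf : ∀ i, ContDiff ℝ ∞ (fun p => f p i)) :
    ContDiff ℝ ∞ f :=
  contDiff_pi (𝕜 := ℝ) (E := H3) (F' := fun _ : Fin 3 => ℝ) |>.2 hf

theorem contDiff_metric {q u v : H3 → H3} (hq : ContDiff ℝ ∞ q) (hu : ContDiff ℝ ∞ u)
    (hv : ContDiff ℝ ∞ v) : ContDiff ℝ ∞ (fun p => metric (q p) (u p) (v p)) := by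
  have := contDiff_coord hq
  have := contDiff_coord hu
  have := contDiff_coord hv
  simp only [metric_eq]
  fun_prop (disch := assumption)

/-- A form is smooth as soon as its values on constant vectors are. -/
theorem contDiff_form {f : H3 → H3 [⋀^Fin 2]→L[ℝ] ℝ}
    (hf : ∀ u v, ContDiff ℝ ∞ (fun p => f p ![u, v])) : ContDiff ℝ ∞ f := by
  let b : Module.Basis (Fin 3) ℝ H3 := Pi.basisFun ℝ (Fin 3)
  let Φ : (H3 [⋀^Fin 2]→L[ℝ] ℝ) →ₗ[ℝ] ((Fin 2 → Fin 3) → ℝ) :=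
    { toFun := fun A i => A (fun j => b (i j))
      map_add' := fun A B => rfl
      map_smul' := fun c A => rfl }
  have hΦ : Function.Injective Φ := by
    intro A B h
    apply ContinuousAlternatingMap.toAlternatingMap_injective
    refine Module.Basis.ext_alternating b fun i _ => ?_
    exact congrFun h i
  obtain ⟨Γ, hΓ⟩ := Φ.exists_leftInverse_of_injective (LinearMap.ker_eq_bot.2 hΦ)
  have e : f = fun p => Γ.toContinuousLinearMap (Φ (f p)) := by
    funext p
    exact (congrArg (fun T => T (f p)) hΓ).symm
  rw [e]
  refine Γ.toContinuousLinearMap.contDiff.comp (contDiff_pi.2 fun i => ?_)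
  have : (fun p => Φ (f p) i) = fun p => f p ![b (i 0), b (i 1)] := by
    funext p
    change f p _ = f p _
    congr 1
    funext j
    fin_cases j <;> rfl
  rw [this]
  exact hf _ _

/-! ### Lorentz forces and the action of `Iso(H₃) × ℝ*` -/

/-- A Lorentz force on `H₃`: a smooth `(1,1)`-tensor `F` such that `(u, v) ↦ g(F u, v)` is a
closed smooth `2`-form (so that, in particular, `F` is skew-symmetric for the metric `g`). -/
@[ext] structure LorentzForce where
  toFun : H3 → H3 →L[ℝ] H3
  contDiff : ContDiff ℝ ∞ toFun
  closed : ∃ Ω : H3 → H3 [⋀^Fin 2]→L[ℝ] ℝ, ContDiff ℝ ∞ Ω ∧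
    (∀ p u v, Ω p ![u, v] = metric p (toFun p u) v) ∧ ∀ p, extDeriv Ω p = 0

/-- `(ψ, r) · F = r ψ_* ∘ F ∘ ψ_*⁻¹`. -/
def act (ψ : Iso) (r : ℝˣ) (F : LorentzForce) : LorentzForce where
  toFun p := (r : ℝ) • (fderiv ℝ ψ.1 (ψ.1.symm p)).comp
    ((F.toFun (ψ.1.symm p)).comp (fderiv ℝ ψ.1.symm p))
  contDiff := by
    obtain ⟨ψ, h1, h2, h3⟩ := ψ
    have d1 : ContDiff ℝ ∞ (fun p => fderiv ℝ ψ (ψ.symm p)) :=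
      (h1.fderiv_right (m := ∞) (by simp)).comp h2
    have d2 : ContDiff ℝ ∞ (fun p => fderiv ℝ ψ.symm p) := h2.fderiv_right (m := ∞) (by simp)
    exact (d1.clm_comp ((F.contDiff.comp h2).clm_comp d2)).const_smul (r : ℝ)
  closed := by
    obtain ⟨Ω, hs, hΩ, hd⟩ := F.closed
    have h1 := ψ.2.1
    have h2 := ψ.2.2.1
    have h3 := ψ.2.2.2
    have d2 : ContDiff ℝ ∞ (fun p => fderiv ℝ ψ.1.symm p) := h2.fderiv_right (m := ∞) (by simp)
    have hs' : ContDiff ℝ ∞ (fun p =>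
        (Ω (ψ.1.symm p)).compContinuousLinearMap (fderiv ℝ ψ.1.symm p)) := by
      refine contDiff_form fun u v => ?_
      have e : ∀ p, ((Ω (ψ.1.symm p)).compContinuousLinearMap (fderiv ℝ ψ.1.symm p)) ![u, v]
          = metric (ψ.1.symm p) (F.toFun (ψ.1.symm p) (fderiv ℝ ψ.1.symm p u))
            (fderiv ℝ ψ.1.symm p v) := by
        intro p
        rw [← hΩ, ContinuousAlternatingMap.compContinuousLinearMap_apply]
        congr 1
        funext i
        fin_cases i <;> rfl
      simp only [e]
      exact contDiff_metric h2
        ((F.contDiff.comp h2).clm_apply (d2.clm_apply contDiff_const))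
        (d2.clm_apply contDiff_const)
    refine ⟨(r : ℝ) • fun p =>
      (Ω (ψ.1.symm p)).compContinuousLinearMap (fderiv ℝ ψ.1.symm p), ?_, ?_, ?_⟩
    · exact hs'.const_smul (r : ℝ)
    · intro p u v
      have key := h3 (ψ.1.symm p) (F.toFun (ψ.1.symm p) (fderiv ℝ ψ.1.symm p u))
        (fderiv ℝ ψ.1.symm p v)
      have e : (fderiv ℝ ψ.1.symm p) ∘ ![u, v]
          = ![fderiv ℝ ψ.1.symm p u, fderiv ℝ ψ.1.symm p v] := by
        funext i
        fin_cases i <;> rfl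
      rw [Iso.fderiv_apply_symm, Equiv.apply_symm_apply, ← hΩ] at key
      simp only [Pi.smul_apply, ContinuousAlternatingMap.smul_apply,
        ContinuousAlternatingMap.compContinuousLinearMap_apply, e, ← key]
      simp only [metric_eq, _root_.smul_apply, ContinuousLinearMap.comp_apply,
        smul_coord, smul_eq_mul]
      ring
    · intro p
      rw [extDeriv_smul, extDeriv_pullback (r := ∞)
        (hs.differentiable (by simp) _) h2.contDiffAt (by
          simp only [minSmoothness_of_isRCLikeNormedField]
          exact WithTop.coe_le_coe.2 le_top), hd]
      ext v
      simp

instance instMulAction : MulAction (Iso × ℝˣ) LorentzForce where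
  smul g F := act g.1 g.2 F
  one_smul F := by
    apply LorentzForce.ext
    funext p
    change ((1 : ℝˣ) : ℝ) • (fderiv ℝ id p).comp ((F.toFun p).comp (fderiv ℝ id p)) = F.toFun p
    ext1 u
    simp
  mul_smul := by
    rintro ⟨φ, r⟩ ⟨ψ, s⟩ F
    apply LorentzForce.ext
    funext p
    have e1 : fderiv ℝ (φ.1 ∘ ψ.1) (ψ.1.symm (φ.1.symm p)) =
        (fderiv ℝ φ.1 (φ.1.symm p)).comp (fderiv ℝ ψ.1 (ψ.1.symm (φ.1.symm p))) := by
      have := fderiv_comp (ψ.1.symm (φ.1.symm p)) (g := φ.1) (f := ψ.1)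
        (φ.2.1.differentiable (by simp) _) (ψ.2.1.differentiable (by simp) _)
      rwa [Equiv.apply_symm_apply] at this
    have e2 : fderiv ℝ (ψ.1.symm ∘ φ.1.symm) p =
        (fderiv ℝ ψ.1.symm (φ.1.symm p)).comp (fderiv ℝ φ.1.symm p) :=
      fderiv_comp p (ψ.2.2.1.differentiable (by simp) _) (φ.2.2.1.differentiable (by simp) _)
    change ((r * s : ℝˣ) : ℝ) • (fderiv ℝ (φ.1 ∘ ψ.1) (ψ.1.symm (φ.1.symm p))).comp
        ((F.toFun (ψ.1.symm (φ.1.symm p))).comp (fderiv ℝ (ψ.1.symm ∘ φ.1.symm) p)) =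
      (r : ℝ) • (fderiv ℝ φ.1 (φ.1.symm p)).comp
        (((s : ℝ) • (fderiv ℝ ψ.1 (ψ.1.symm (φ.1.symm p))).comp
          ((F.toFun (ψ.1.symm (φ.1.symm p))).comp (fderiv ℝ ψ.1.symm (φ.1.symm p)))).comp
            (fderiv ℝ φ.1.symm p))
    rw [e1, e2]
    ext1 u
    simp [mul_smul]

theorem smul_def (ψ : Iso) (r : ℝˣ) (F : LorentzForce) (p : H3) :
    ((ψ, r) • F).toFun p = (r : ℝ) • (fderiv ℝ ψ.1 (ψ.1.symm p)).comp
      ((F.toFun (ψ.1.symm p)).comp (fderiv ℝ ψ.1.symm p)) := rfl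

/-- `F` is left-invariant: `(L_a)_* ∘ F = F ∘ (L_a)_*` for all `a`. -/
def LorentzForce.IsLeftInvariant (F : LorentzForce) : Prop :=
  ∀ a p u : H3, fderiv ℝ (fun q : H3 => a * q) p (F.toFun p u)
    = F.toFun (a * p) (fderiv ℝ (fun q : H3 => a * q) p u)

/-- The set of nontrivial (nonzero) left-invariant Lorentz forces. -/
def nontrivialLeftInvariant : Set LorentzForce :=
  {F | F.IsLeftInvariant ∧ F.toFun ≠ 0}

/-! ### The left-invariant forces `F_{U,ρ}` -/

/-- The endomorphism of `𝔥₃ = T_e H₃` whose matrix in the basis `e₁, e₂, e₃` is that of `F_{U,ρ}`,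
for `U = β e₁ + α e₂`, `β = U 0`, `α = U 1`. -/
def forceAtOne (U : Fin 2 → ℝ) (ρ : ℝ) : H3 →L[ℝ] H3 :=
  LinearMap.toContinuousLinearMap (Matrix.toLin'
    !![0, -ρ, -U 0;
       ρ, 0, -U 1;
       U 0, U 1, 0] : (Fin 3 → ℝ) →ₗ[ℝ] (Fin 3 → ℝ))

theorem forceAtOne_apply (U : Fin 2 → ℝ) (ρ : ℝ) (u : H3) :
    forceAtOne U ρ u = mk (-ρ * u 1 - U 0 * u 2) (ρ * u 0 - U 1 * u 2)
      (U 0 * u 0 + U 1 * u 1) := by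
  have key : ∀ v : Fin 3 → ℝ, Matrix.toLin' !![0, -ρ, -U 0; ρ, 0, -U 1; U 0, U 1, 0] v =
      ![-ρ * v 1 - U 0 * v 2, ρ * v 0 - U 1 * v 2, U 0 * v 0 + U 1 * v 1] := by
    intro v
    funext i
    fin_cases i <;> simp [Matrix.toLin'_apply, Matrix.mulVec, dotProduct, Fin.sum_univ_three]
      <;> ring
  exact key u

theorem contDiff_dL : ContDiff ℝ ∞ dL := by
  have h := contDiff_coord (contDiff_id : ContDiff ℝ ∞ (id : H3 → H3))
  have h0 := h 0
  have h1 := h 1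
  simp only [id_eq] at h0 h1
  rw [contDiff_clm_apply_iff]
  intro u
  refine contDiff_of_coord fun i => ?_
  simp only [dL_apply]
  fin_cases i
  · exact contDiff_const
  · exact contDiff_const
  · change ContDiff ℝ ∞ (fun p : H3 => u 2 + (p 0 * u 1 - p 1 * u 0) / 2)
    fun_prop (disch := assumption)

theorem contDiff_dL_inv : ContDiff ℝ ∞ (fun p : H3 => dL p⁻¹) := by
  have e : (fun p : H3 => p⁻¹) = fun p => -p := by
    funext p
    apply ext3 <;> rfl
  have h : ContDiff ℝ ∞ (fun p : H3 => p⁻¹) := by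
    rw [e]
    exact contDiff_neg
  exact contDiff_dL.comp h

/-- The value at the identity of the `2`-form of `F_{U,ρ}`. -/
def formAtOne (U : Fin 2 → ℝ) (ρ : ℝ) : H3 [⋀^Fin 2]→L[ℝ] ℝ where
  toFun w := ρ * (w 0 0 * w 1 1 - w 0 1 * w 1 0) + U 0 * (w 0 0 * w 1 2 - w 0 2 * w 1 0)
    + U 1 * (w 0 1 * w 1 2 - w 0 2 * w 1 1)
  map_update_add' {inst} w i x y := by
    rw [Subsingleton.elim inst (instDecidableEqFin 2)]
    fin_cases i <;> simp <;> ring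
  map_update_smul' {inst} w i c x := by
    rw [Subsingleton.elim inst (instDecidableEqFin 2)]
    fin_cases i <;> simp <;> ring
  cont := by
    have h : ∀ (j : Fin 2) (i : Fin 3), Continuous (fun w : Fin 2 → H3 => w j i) := fun j i =>
      (ContinuousLinearMap.proj (R := ℝ) (φ := fun _ : Fin 3 => ℝ) i).continuous.comp
        (continuous_apply j)
    fun_prop (disch := assumption)
  map_eq_zero_of_eq' w i j hw hij := by
    have : w 0 = w 1 := by
      fin_cases i <;> fin_cases j <;> first | exact absurd rfl hij | exact hw | exact hw.symm
    rw [this]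
    ring

theorem formAtOne_apply (U : Fin 2 → ℝ) (ρ : ℝ) (w : Fin 2 → H3) : formAtOne U ρ w =
    ρ * (w 0 0 * w 1 1 - w 0 1 * w 1 0) + U 0 * (w 0 0 * w 1 2 - w 0 2 * w 1 0)
    + U 1 * (w 0 1 * w 1 2 - w 0 2 * w 1 1) := rfl

/-- The `2`-form of `F_{U,ρ}`. -/
def form (U : Fin 2 → ℝ) (ρ : ℝ) (p : H3) : H3 [⋀^Fin 2]→L[ℝ] ℝ :=
  (formAtOne U ρ).compContinuousLinearMap (dL p⁻¹)

theorem form_apply (U : Fin 2 → ℝ) (ρ : ℝ) (p : H3) (w : Fin 2 → H3) : form U ρ p w =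
    ρ * (w 0 0 * w 1 1 - w 0 1 * w 1 0)
    + U 0 * (w 0 0 * (w 1 2 + (p 1 * w 1 0 - p 0 * w 1 1) / 2)
      - (w 0 2 + (p 1 * w 0 0 - p 0 * w 0 1) / 2) * w 1 0)
    + U 1 * (w 0 1 * (w 1 2 + (p 1 * w 1 0 - p 0 * w 1 1) / 2)
      - (w 0 2 + (p 1 * w 0 0 - p 0 * w 0 1) / 2) * w 1 1) := by
  rw [form, ContinuousAlternatingMap.compContinuousLinearMap_apply, formAtOne_apply]
  simp [dL_apply]
  ring

theorem form_eq_metric (U : Fin 2 → ℝ) (ρ : ℝ) (p u v : H3) :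
    form U ρ p ![u, v] = metric p (dL p (forceAtOne U ρ (dL p⁻¹ u))) v := by
  rw [metric, form_apply]
  simp [Fin.sum_univ_three, dL_apply, forceAtOne_apply]
  ring

theorem contDiff_form_force (U : Fin 2 → ℝ) (ρ : ℝ) : ContDiff ℝ ∞ (form U ρ) := by
  refine contDiff_form fun u v => ?_
  simp only [form_eq_metric]
  exact contDiff_metric contDiff_id (contDiff_dL.clm_apply (contDiff_const.clm_apply
    (contDiff_dL_inv.clm_apply contDiff_const))) contDiff_const

/-- The derivative of the coefficients of the `2`-form of `F_{U,ρ}`, which are affine in `p`. -/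
theorem fderiv_form_apply (U : Fin 2 → ℝ) (ρ : ℝ) (p h : H3) (w : Fin 2 → H3) :
    fderiv ℝ (fun q => form U ρ q w) p h =
      U 0 * (w 0 0 * ((h 1 * w 1 0 - h 0 * w 1 1) / 2)
        - (h 1 * w 0 0 - h 0 * w 0 1) / 2 * w 1 0)
      + U 1 * (w 0 1 * ((h 1 * w 1 0 - h 0 * w 1 1) / 2)
        - (h 1 * w 0 0 - h 0 * w 0 1) / 2 * w 1 1) := by
  let L : H3 →L[ℝ] ℝ := LinearMap.toContinuousLinearMap
    { toFun := fun h => U 0 * (w 0 0 * ((h 1 * w 1 0 - h 0 * w 1 1) / 2)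
        - (h 1 * w 0 0 - h 0 * w 0 1) / 2 * w 1 0)
        + U 1 * (w 0 1 * ((h 1 * w 1 0 - h 0 * w 1 1) / 2)
        - (h 1 * w 0 0 - h 0 * w 0 1) / 2 * w 1 1)
      map_add' := fun x y => by
        simp
        ring
      map_smul' := fun c x => by
        simp
        ring }
  have hL : ∀ h, L h = U 0 * (w 0 0 * ((h 1 * w 1 0 - h 0 * w 1 1) / 2)
        - (h 1 * w 0 0 - h 0 * w 0 1) / 2 * w 1 0)
        + U 1 * (w 0 1 * ((h 1 * w 1 0 - h 0 * w 1 1) / 2)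
        - (h 1 * w 0 0 - h 0 * w 0 1) / 2 * w 1 1) := fun _ => rfl
  have e : (fun q => form U ρ q w) = fun q => form U ρ 1 w + L q := by
    funext q
    rw [form_apply, form_apply, hL]
    simp
    ring
  rw [e, (L.hasFDerivAt.const_add _).fderiv, hL]

theorem extDeriv_form (U : Fin 2 → ℝ) (ρ : ℝ) (p : H3) : extDeriv (form U ρ) p = 0 := by
  ext w
  rw [extDeriv_apply ((contDiff_form_force U ρ).differentiable (by simp) p)]
  simp only [fderiv_form_apply, Fin.removeNth]
  change (∑ i : Fin 3, _) = _
  rw [Fin.sum_univ_three]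
  simp [Fin.succAbove]
  ring

/-- `F_{U,ρ}`, the left-invariant Lorentz force with value `forceAtOne U ρ` at the identity. -/
def force (U : Fin 2 → ℝ) (ρ : ℝ) : LorentzForce where
  toFun p := (dL p).comp ((forceAtOne U ρ).comp (dL p⁻¹))
  contDiff := contDiff_dL.clm_comp (contDiff_const.clm_comp contDiff_dL_inv)
  closed := ⟨form U ρ, contDiff_form_force U ρ, form_eq_metric U ρ, extDeriv_form U ρ⟩

/-! ### Left translations, the action of `O(2)` and semidirect products -/

/-- The group `O(2)`. -/
abbrev O2 := Matrix.orthogonalGroup (Fin 2) ℝ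

/-- The map `(V, Z) ↦ (B V, det(B) Z)` for a `2 × 2` matrix `B`. -/
def rot (B : Matrix (Fin 2) (Fin 2) ℝ) (p : H3) : H3 :=
  mk (B 0 0 * p 0 + B 0 1 * p 1) (B 1 0 * p 0 + B 1 1 * p 1) (B.det * p 2)

theorem rot_mul_matrix (A B : Matrix (Fin 2) (Fin 2) ℝ) (p : H3) :
    rot (A * B) p = rot A (rot B p) := by
  apply ext3 <;> simp [rot, Matrix.mul_apply, Fin.sum_univ_two] <;> ring

theorem rot_one_matrix (p : H3) : rot 1 p = p := by
  apply ext3 <;> simp [rot]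

/-- `rot B` as a linear map; it is its own differential. -/
def rotL (B : Matrix (Fin 2) (Fin 2) ℝ) : H3 →L[ℝ] H3 :=
  LinearMap.toContinuousLinearMap
    { toFun := rot B
      map_add' := fun u v => by
        apply ext3 <;> simp [rot] <;> ring
      map_smul' := fun c u => by
        apply ext3 <;> simp [rot] <;> ring }

theorem metric_rot (B : O2) (p u v : H3) :
    metric (rot B.1 p) (rot B.1 u) (rot B.1 v) = metric p u v := by
  have h := Matrix.mem_orthogonalGroup_iff' (Fin 2) ℝ |>.1 B.2
  have h00 := congrFun (congrFun h 0) 0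
  have h01 := congrFun (congrFun h 0) 1
  have h11 := congrFun (congrFun h 1) 1
  simp [Matrix.mul_apply, Fin.sum_univ_two] at h00 h01 h11
  have hd : B.1.det * B.1.det = 1 := by
    have := congrArg Matrix.det h
    simpa [Matrix.det_mul, Matrix.star_eq_conjTranspose] using this
  have e : ∀ w : H3, (rot B.1 p) 1 * (rot B.1 w) 0 - (rot B.1 p) 0 * (rot B.1 w) 1
      = B.1.det * (p 1 * w 0 - p 0 * w 1) := by
    intro w
    simp [rot, Matrix.det_fin_two]
    ring
  have e2 : ∀ w : H3, (rot B.1 w) 2 = B.1.det * w 2 := fun _ => rfl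
  rw [metric_eq, metric_eq, e, e, e2, e2]
  simp only [rot, mk_zero, mk_one]
  linear_combination (u 0 * v 0) * h00 + (u 0 * v 1 + u 1 * v 0) * h01 + (u 1 * v 1) * h11
    + (u 2 + (p 1 * u 0 - p 0 * u 1) / 2) * (v 2 + (p 1 * v 0 - p 0 * v 1) / 2) * hd

/-- The action of `O(2)` on `H₃` by automorphisms, `B · (V, Z) = (B V, det(B) Z)`. -/
def autO2 : O2 →* MulAut H3 where
  toFun B :=
    { toFun := rot B.1
      invFun := rot (B⁻¹ : O2).1
      left_inv := fun p => by
        rw [← rot_mul_matrix, ← Submonoid.coe_mul, inv_mul_cancel]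
        exact rot_one_matrix p
      right_inv := fun p => by
        rw [← rot_mul_matrix, ← Submonoid.coe_mul, mul_inv_cancel]
        exact rot_one_matrix p
      map_mul' := fun p q => by
        apply ext3 <;> simp [rot, Matrix.det_fin_two] <;> ring }
  map_one' := by
    ext1 p
    exact rot_one_matrix p
  map_mul' A B := by
    ext1 p
    exact rot_mul_matrix A.1 B.1 p

/-- `L_a` as an isometry. -/
def leftTranslation : H3 →* Iso where
  toFun a := ⟨Equiv.mulLeft a, by
    have h : ∀ b : H3, ContDiff ℝ ∞ (fun q : H3 => b * q) := by
      intro b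
      simp only [mul_eq_add_dL]
      exact contDiff_const.add (dL b).contDiff
    refine ⟨h a, h a⁻¹, fun p u v => ?_⟩
    change metric (a * p) (fderiv ℝ (fun q : H3 => a * q) p u)
      (fderiv ℝ (fun q : H3 => a * q) p v) = _
    rw [(hasFDerivAt_mul_left a p).fderiv, metric_mul_left]⟩
  map_one' := by
    apply Subtype.ext
    ext1 p
    exact one_mul p
  map_mul' a b := by
    apply Subtype.ext
    ext1 p
    exact mul_assoc a b p

/-- The automorphism of `H₃` given by `B ∈ O(2)`, as an isometry. -/
def orthogonalAut : O2 →* Iso where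
  toFun B := ⟨(autO2 B).toEquiv, by
    refine ⟨(rotL B.1).contDiff, (rotL (B⁻¹ : O2).1).contDiff, fun p u v => ?_⟩
    change metric (rot B.1 p) (fderiv ℝ (rotL B.1) p u) (fderiv ℝ (rotL B.1) p v) = _
    rw [(rotL B.1).hasFDerivAt.fderiv]
    exact metric_rot B p u v⟩
  map_one' := by
    apply Subtype.ext
    ext1 p
    exact rot_one_matrix p
  map_mul' A B := by
    apply Subtype.ext
    ext1 p
    exact rot_mul_matrix A.1 B.1 p

/-- For a subgroup `K ≤ O(2) × ℝ*`, its action on `H₃` through the projection to `O(2)`. -/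
def autK (K : Subgroup (O2 × ℝˣ)) : K →* MulAut H3 :=
  autO2.comp ((MonoidHom.fst O2 ℝˣ).comp K.subtype)

/-- The homomorphism `H₃ ⋊ K → Iso(H₃) × ℝ*`, `(a, (B, r)) ↦ (L_a ∘ B, r)`. -/
def semidirectHom (K : Subgroup (O2 × ℝˣ)) : H3 ⋊[autK K] K →* Iso × ℝˣ :=
  SemidirectProduct.lift (leftTranslation.prod 1)
    ((orthogonalAut.prodMap (MonoidHom.id ℝˣ)).comp K.subtype) (by
      intro k
      ext1 a
      refine Prod.ext ?_ ?_
      · apply Subtype.ext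
        ext1 p
        change autO2 k.1.1 a * p = autO2 k.1.1 (a * (autO2 k.1.1).symm p)
        rw [map_mul, MulEquiv.apply_symm_apply]
      · change (1 : ℝˣ) = k.1.2 * 1 * k.1.2⁻¹
        simp)

theorem semidirectHom_apply (K : Subgroup (O2 × ℝˣ)) (a p : H3) (k : K) :
    (semidirectHom K ⟨a, k⟩).1.1 p = a * rot k.1.1.1 p ∧
      (semidirectHom K ⟨a, k⟩).2 = k.1.2 := by
  refine ⟨rfl, ?_⟩
  change 1 * k.1.2 = k.1.2
  simp

/-- A subgroup `H` of `Iso(H₃) × ℝ*` equals `H₃ ⋊ K`: the homomorphism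
`(a, (B, r)) ↦ (L_a ∘ B, r)` maps `H₃ ⋊ K` isomorphically onto `H`. -/
def EqSemidirect (H : Subgroup (Iso × ℝˣ)) (K : Subgroup (O2 × ℝˣ)) : Prop :=
  Function.Injective (semidirectHom K) ∧ (semidirectHom K).range = H

/-! ### The subgroups of `O(2) × ℝ*` in the isotropy groups -/

/-- The reflection `S ∈ O(2)` with `S e₁ = e₁` and `S e₂ = -e₂`. -/
def S : O2 := ⟨!![1, 0; 0, -1], by
  rw [Matrix.mem_orthogonalGroup_iff]
  ext i j
  fin_cases i <;> fin_cases j <;>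
    simp [Matrix.mul_apply, Fin.sum_univ_two]⟩

theorem S_mul_S : S * S = 1 := by
  apply Subtype.ext
  ext i j
  fin_cases i <;> fin_cases j <;> simp [S]

theorem S_inv : S⁻¹ = S := inv_eq_of_mul_eq_one_right S_mul_S

/-- The negative of `B` in `O(2)` is its negative as a matrix. -/
theorem coe_neg_O2 (B : O2) : ((-B : O2) : Matrix (Fin 2) (Fin 2) ℝ) = -B.1 := rfl

/-- `{(Id, 1), (S, -1)}`. -/
def K₁ : Subgroup (O2 × ℝˣ) where
  carrier := {(1, 1), (S, -1)}
  one_mem' := Or.inl rfl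
  mul_mem' := by
    intro x y hx hy
    simp only [Set.mem_insert_iff, Set.mem_singleton_iff] at hx hy ⊢
    rcases hx with (rfl | rfl) <;> rcases hy with (rfl | rfl) <;> simp [S_mul_S]
  inv_mem' := by
    intro x hx
    simp only [Set.mem_insert_iff, Set.mem_singleton_iff] at hx ⊢
    rcases hx with (rfl | rfl) <;> simp [S_inv]

/-- `{(Id, 1), (-S, 1), (-Id, -1), (S, -1)}`. -/
def K₂ : Subgroup (O2 × ℝˣ) where
  carrier := {(1, 1), (-S, 1), (-1, -1), (S, -1)}
  one_mem' := Or.inl rfl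
  mul_mem' := by
    intro x y hx hy
    simp only [Set.mem_insert_iff, Set.mem_singleton_iff] at hx hy ⊢
    rcases hx with (rfl | rfl | rfl | rfl) <;> rcases hy with (rfl | rfl | rfl | rfl) <;> simp [S_mul_S]
  inv_mem' := by
    intro x hx
    simp only [Set.mem_insert_iff, Set.mem_singleton_iff] at hx ⊢
    rcases hx with (rfl | rfl | rfl | rfl) <;> simp [S_inv]

/-- `SO(2) × {1} ∪ SO⁻(2) × {-1}`, with `SO(2)` and `SO⁻(2)` the sets of `B ∈ O(2)` of determinant
`1` and `-1`. -/
def K₃ : Subgroup (O2 × ℝˣ) where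
  carrier := {k | (k.1.1.det = 1 ∧ k.2 = 1) ∨ (k.1.1.det = -1 ∧ k.2 = -1)}
  one_mem' := Or.inl ⟨Matrix.det_one, rfl⟩
  mul_mem' := by
    rintro ⟨A, r⟩ ⟨B, s⟩ hA hB
    have e : (A * B : O2).1.det = A.1.det * B.1.det := Matrix.det_mul _ _
    simp only [Set.mem_ofPred_eq, Prod.mk_mul_mk, e] at hA hB ⊢
    rcases hA with (⟨h1, h2⟩ | ⟨h1, h2⟩) <;> rcases hB with (⟨k1, k2⟩ | ⟨k1, k2⟩) <;>
      simp [h1, h2, k1, k2]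
  inv_mem' := by
    rintro ⟨A, r⟩ hA
    have e : (A⁻¹ : O2).1.det = A.1.det := Matrix.det_transpose _
    simp only [Set.mem_ofPred_eq, Prod.inv_mk, e] at hA ⊢
    rcases hA with (⟨h1, h2⟩ | ⟨h1, h2⟩) <;> simp [h1, h2]

end H3

end

/-!
The theorem rests on the identity `Iso(H₃) = H₃ ⋊ O(2)`
(`H3.exists_leftTranslation_mul_orthogonalAut`), after which everything is linear algebra on
skew-symmetric `3 × 3` matrices.

The isometry group is computed with a moving frame. Write the differential of an isometry `ψ` in the
left-invariant orthonormal frame `E₁, E₂, E₃`; the resulting matrix `A` is a function on `H₃` with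
values in `O(3)`. Since `ψ` is compatible with brackets and `[E₁, E₂] = E₃` is the only nonzero
bracket, `A` satisfies structure equations (`H3.structure_equation`), and together with the
skew-symmetry of `A⁻¹ dA` these determine `dA` as a function of `A` (`H3.connectionForm_koszul`),
as in the Koszul formula. For the bottom row `a` of `A`, which is the pullback of the contact form,
this gives a linear system with constant coefficients depending only on `det A = ± 1`
(`H3.frameMatrixDeriv_row_two`). Its integrability condition coming from `[E₁, E₂] = E₃` forces
`a = ± e₃` (`H3.frameMatrix_row_two`). Then `det A = 1`, all derivatives of `A` vanish, and `A` is
the block diagonal matrix `(B, det B)` of some `B ∈ O(2)`. An isometry with constant frame matrix is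
determined by it and by the image of the identity (`H3.Iso.ext_of_frameMatrix`), so
`ψ = L_a ∘ B`.

A left-invariant Lorentz force is determined by its value at the identity, a skew-symmetric
endomorphism, hence is some `F_{U,ρ}`
(`H3.LorentzForce.IsLeftInvariant.exists_eq_force`). The pair `(L_a ∘ B, r)` maps `F_{U,ρ}` to
`F_{r det(B) B U, r det(B) ρ}` (`H3.smul_force`): left translations act trivially, and the
orbits and isotropy groups are those of `O(2) × ℝ*` acting on the pairs `(U, ρ)`. If `U ≠ 0` it can
be rotated and scaled to `e₁`, after which only the sign of `ρ` is free.
-/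

noncomputable section

namespace H3

/-! ### The left-invariant frame -/

/-- The standard basis `e₁, e₂, e₃` of `𝔥₃ = T_e H₃`, indexed from `0`. -/
def stdBasis : Fin 3 → H3 := ![mk 1 0 0, mk 0 1 0, mk 0 0 1]

theorem stdBasis_zero : stdBasis 0 = mk 1 0 0 := rfl

theorem stdBasis_one : stdBasis 1 = mk 0 1 0 := rfl

theorem stdBasis_two : stdBasis 2 = mk 0 0 1 := rfl

/-- The left-invariant vector field extending the basis vector `stdBasis i`. -/
def frame (i : Fin 3) (p : H3) : H3 := dL p (stdBasis i)

theorem frame_zero (p : H3) : frame 0 p = mk 1 0 (-p 1 / 2) := by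
  apply ext3 <;> simp [frame, dL_apply, stdBasis_zero]

theorem frame_one (p : H3) : frame 1 p = mk 0 1 (p 0 / 2) := by
  apply ext3 <;> simp [frame, dL_apply, stdBasis_one]

theorem frame_two (p : H3) : frame 2 p = mk 0 0 1 := by
  apply ext3 <;> simp [frame, dL_apply, stdBasis_two]

theorem eq_sum_frame (p u : H3) :
    u = u 0 • frame 0 p + u 1 • frame 1 p
      + (u 2 + (p 1 * u 0 - p 0 * u 1) / 2) • frame 2 p := by
  apply ext3 <;> simp [frame_zero, frame_one, frame_two]
  ring

theorem metric_frame (p : H3) (i l : Fin 3) :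
    metric p (frame i p) (frame l p) = if i = l then 1 else 0 := by
  fin_cases i <;> fin_cases l <;>
    simp [metric_eq, frame_zero, frame_one, frame_two, neg_div]

@[simp] theorem sub_coord (u v : H3) (i : Fin 3) : (u - v) i = u i - v i := rfl

@[simp] theorem zero_coord (i : Fin 3) : (0 : H3) i = 0 := rfl

/-- A left-invariant vector field is affine in the base point: `dL q u = u + dL u⁻¹ q - q`. -/
theorem hasFDerivAt_dL_apply (u p : H3) :
    HasFDerivAt (fun q => dL q u) (dL u⁻¹ - ContinuousLinearMap.id ℝ H3) p := by
  have e : (fun q => dL q u) = fun q => u + (dL u⁻¹ - ContinuousLinearMap.id ℝ H3) q := by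
    funext q
    apply ext3 <;> simp [dL_apply]
    ring
  rw [e]
  exact (dL u⁻¹ - ContinuousLinearMap.id ℝ H3).hasFDerivAt.const_add u

/-- The derivative of a function along the frame field `frame i`. -/
def frameDeriv (i : Fin 3) (f : H3 → ℝ) (p : H3) : ℝ := fderiv ℝ f p (frame i p)

theorem contDiff_frame (i : Fin 3) : ContDiff ℝ ∞ (frame i) :=
  contDiff_dL.clm_apply contDiff_const

theorem contDiff_frameDeriv {f : H3 → ℝ} (hf : ContDiff ℝ ∞ f) (i : Fin 3) :
    ContDiff ℝ ∞ (frameDeriv i f) :=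
  (hf.fderiv_right (m := ∞) (by simp)).clm_apply (contDiff_frame i)

theorem frameDeriv_add {f g : H3 → ℝ} (hf : ContDiff ℝ ∞ f) (hg : ContDiff ℝ ∞ g)
    (i : Fin 3) (p : H3) :
    frameDeriv i (fun q => f q + g q) p = frameDeriv i f p + frameDeriv i g p := by
  simp only [frameDeriv]
  rw [fderiv_fun_add (hf.differentiable (by simp) p) (hg.differentiable (by simp) p)]
  rfl

theorem frameDeriv_sub {f g : H3 → ℝ} (hf : ContDiff ℝ ∞ f) (hg : ContDiff ℝ ∞ g)
    (i : Fin 3) (p : H3) :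
    frameDeriv i (fun q => f q - g q) p = frameDeriv i f p - frameDeriv i g p := by
  simp only [frameDeriv]
  rw [fderiv_fun_sub (hf.differentiable (by simp) p) (hg.differentiable (by simp) p)]
  rfl

theorem frameDeriv_mul {f g : H3 → ℝ} (hf : ContDiff ℝ ∞ f) (hg : ContDiff ℝ ∞ g)
    (i : Fin 3) (p : H3) :
    frameDeriv i (fun q => f q * g q) p
      = f p * frameDeriv i g p + g p * frameDeriv i f p := by
  simp only [frameDeriv]
  rw [fderiv_fun_mul (hf.differentiable (by simp) p) (hg.differentiable (by simp) p)]
  rfl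

theorem frameDeriv_const (c : ℝ) (i : Fin 3) (p : H3) :
    frameDeriv i (fun _ => c) p = 0 := by
  simp [frameDeriv]

theorem frameDeriv_const_mul {f : H3 → ℝ} (hf : ContDiff ℝ ∞ f) (c : ℝ)
    (i : Fin 3) (p : H3) :
    frameDeriv i (fun q => c * f q) p = c * frameDeriv i f p := by
  rw [frameDeriv_mul contDiff_const hf, frameDeriv_const, mul_zero, add_zero]

theorem fderiv_coord {f : H3 → H3} (hf : ContDiff ℝ ∞ f) (j : Fin 3) (p u : H3) :
    fderiv ℝ f p u j = fderiv ℝ (fun q => f q j) p u := by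
  have h := (ContinuousLinearMap.proj (R := ℝ) (φ := fun _ : Fin 3 => ℝ) j).hasFDerivAt.comp p
    (hf.differentiable (by simp) p).hasFDerivAt
  exact (congrArg (fun T : H3 →L[ℝ] ℝ => T u) h.fderiv).symm

/-- A function all of whose derivatives along the frame vanish is constant. -/
theorem eq_of_frameDeriv_eq_zero {f : H3 → ℝ} (hf : ContDiff ℝ ∞ f)
    (h : ∀ i p, frameDeriv i f p = 0) (p q : H3) : f p = f q := by
  refine is_const_of_fderiv_eq_zero (𝕜 := ℝ) (hf.differentiable (by simp)) (fun x => ?_) p q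
  ext1 u
  rw [eq_sum_frame x u]
  have h0 := h 0 x
  have h1 := h 1 x
  have h2 := h 2 x
  simp only [frameDeriv] at h0 h1 h2
  simp [h0, h1, h2]

theorem frameDeriv_frameDeriv {f : H3 → ℝ} (hf : ContDiff ℝ ∞ f) (i j : Fin 3) (p : H3) :
    frameDeriv i (frameDeriv j f) p = fderiv ℝ (fderiv ℝ f) p (frame i p) (frame j p)
      + fderiv ℝ f p (dL (stdBasis j)⁻¹ (frame i p) - frame i p) := by
  have h1 : HasFDerivAt (fderiv ℝ f) (fderiv ℝ (fderiv ℝ f) p) p :=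
    ((hf.fderiv_right (m := ∞) (by simp)).differentiable (by simp) p).hasFDerivAt
  have h := h1.clm_apply (hasFDerivAt_dL_apply (stdBasis j) p)
  have e : frameDeriv j f = fun q => fderiv ℝ f q (dL q (stdBasis j)) := rfl
  rw [frameDeriv, e, h.fderiv]
  simp [frame, add_comm]

/-- By the symmetry of the second derivative, the commutator of two frame fields only involves the
derivatives of the fields. -/
theorem frameDeriv_commutator {f : H3 → ℝ} (hf : ContDiff ℝ ∞ f) (i j : Fin 3) (p : H3) :
    frameDeriv i (frameDeriv j f) p - frameDeriv j (frameDeriv i f) p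
      = fderiv ℝ f p ((dL (stdBasis j)⁻¹ (frame i p) - frame i p)
        - (dL (stdBasis i)⁻¹ (frame j p) - frame j p)) := by
  have hs : fderiv ℝ (fderiv ℝ f) p (frame i p) (frame j p)
      = fderiv ℝ (fderiv ℝ f) p (frame j p) (frame i p) :=
    (hf.contDiffAt.isSymmSndFDerivAt (by
      simp only [minSmoothness_of_isRCLikeNormedField]
      exact WithTop.coe_le_coe.2 le_top)).eq _ _
  rw [frameDeriv_frameDeriv hf, frameDeriv_frameDeriv hf, hs, map_sub _ (_ - _) (_ - _)]
  ring

/-- The bracket relation `[E₁, E₂] = E₃`. -/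
theorem frameDeriv_zero_one {f : H3 → ℝ} (hf : ContDiff ℝ ∞ f) (p : H3) :
    frameDeriv 0 (frameDeriv 1 f) p - frameDeriv 1 (frameDeriv 0 f) p = frameDeriv 2 f p := by
  rw [frameDeriv_commutator hf, frameDeriv]
  congr 1
  apply ext3 <;> simp [frame, dL_apply, stdBasis_zero, stdBasis_one, stdBasis_two]
  ring

theorem frameDeriv_zero_two {f : H3 → ℝ} (hf : ContDiff ℝ ∞ f) (p : H3) :
    frameDeriv 0 (frameDeriv 2 f) p = frameDeriv 2 (frameDeriv 0 f) p := by
  rw [← sub_eq_zero, frameDeriv_commutator hf, ← map_zero (fderiv ℝ f p)]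
  congr 1
  apply ext3 <;> simp [frame, dL_apply, stdBasis_zero, stdBasis_two]

theorem frameDeriv_one_two {f : H3 → ℝ} (hf : ContDiff ℝ ∞ f) (p : H3) :
    frameDeriv 1 (frameDeriv 2 f) p = frameDeriv 2 (frameDeriv 1 f) p := by
  rw [← sub_eq_zero, frameDeriv_commutator hf, ← map_zero (fderiv ℝ f p)]
  congr 1
  apply ext3 <;> simp [frame, dL_apply, stdBasis_one, stdBasis_two]

/-! ### The structure equations of an isometry -/

/-- The matrix of the differential of `ψ` in the left-invariant frame: the entry `(j, i)` at `p` is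
the `j`-th frame coordinate at `ψ p` of the image of `frame i p`. -/
def frameMatrix (ψ : H3 → H3) (p : H3) : Matrix (Fin 3) (Fin 3) ℝ :=
  Matrix.of fun j i => dL (ψ p)⁻¹ (fderiv ℝ ψ p (frame i p)) j

theorem contDiff_frameMatrix {ψ : H3 → H3} (hψ : ContDiff ℝ ∞ ψ) (j i : Fin 3) :
    ContDiff ℝ ∞ (fun p => frameMatrix ψ p j i) :=
  contDiff_coord ((contDiff_dL_inv.comp hψ).clm_apply
    ((hψ.fderiv_right (m := ∞) (by simp)).clm_apply (contDiff_frame i))) j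

theorem frameMatrix_zero {ψ : H3 → H3} (hψ : ContDiff ℝ ∞ ψ) (i : Fin 3) (p : H3) :
    frameMatrix ψ p 0 i = frameDeriv i (fun q => ψ q 0) p := by
  simp [frameMatrix, dL_apply, fderiv_coord hψ, frameDeriv]

theorem frameMatrix_one {ψ : H3 → H3} (hψ : ContDiff ℝ ∞ ψ) (i : Fin 3) (p : H3) :
    frameMatrix ψ p 1 i = frameDeriv i (fun q => ψ q 1) p := by
  simp [frameMatrix, dL_apply, fderiv_coord hψ, frameDeriv]

theorem frameMatrix_two {ψ : H3 → H3} (hψ : ContDiff ℝ ∞ ψ) (i : Fin 3) (p : H3) :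
    frameMatrix ψ p 2 i = frameDeriv i (fun q => ψ q 2) p
      + (1 / 2) * (ψ p 1 * frameDeriv i (fun q => ψ q 0) p
        - ψ p 0 * frameDeriv i (fun q => ψ q 1) p) := by
  simp [frameMatrix, dL_apply, fderiv_coord hψ, frameDeriv]
  ring

/-- An isometry has an orthogonal matrix in the left-invariant frame. -/
theorem frameMatrix_transpose_mul (ψ : Iso) (p : H3) :
    (frameMatrix ψ.1 p).transpose * frameMatrix ψ.1 p = 1 := by
  ext i l
  have h := (ψ.2.2.2 p (frame i p) (frame l p)).trans (metric_frame p i l)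
  rw [Matrix.one_apply, ← h, Matrix.mul_apply]
  rfl

/-- The derivative of `A j i` in the direction `frame k`, for `A` the frame matrix of `ψ`. -/
def frameMatrixDeriv (ψ : H3 → H3) (p : H3) (k j i : Fin 3) : ℝ :=
  frameDeriv k (fun q => frameMatrix ψ q j i) p

theorem frameMatrix_orthonormal (ψ : Iso) (p : H3) (i l : Fin 3) :
    frameMatrix ψ.1 p 0 i * frameMatrix ψ.1 p 0 l + frameMatrix ψ.1 p 1 i * frameMatrix ψ.1 p 1 l
      + frameMatrix ψ.1 p 2 i * frameMatrix ψ.1 p 2 l = if i = l then 1 else 0 := by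
  have h := congrFun (congrFun (frameMatrix_transpose_mul ψ p) i) l
  rwa [Matrix.mul_apply, Fin.sum_univ_three, Matrix.one_apply] at h

theorem frameMatrixDeriv_skew (ψ : Iso) (p : H3) (k i l : Fin 3) :
    (∑ j, frameMatrix ψ.1 p j i * frameMatrixDeriv ψ.1 p k j l)
      = -∑ j, frameMatrix ψ.1 p j l * frameMatrixDeriv ψ.1 p k j i := by
  have c := contDiff_frameMatrix ψ.2.1
  have h : frameDeriv k (fun q => frameMatrix ψ.1 q 0 i * frameMatrix ψ.1 q 0 l
      + frameMatrix ψ.1 q 1 i * frameMatrix ψ.1 q 1 l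
      + frameMatrix ψ.1 q 2 i * frameMatrix ψ.1 q 2 l) p = 0 := by
    simp only [frameMatrix_orthonormal ψ _ i l, frameDeriv_const]
  rw [frameDeriv_add (((c 0 i).mul (c 0 l)).add ((c 1 i).mul (c 1 l))) ((c 2 i).mul (c 2 l)),
    frameDeriv_add ((c 0 i).mul (c 0 l)) ((c 1 i).mul (c 1 l)),
    frameDeriv_mul (c 0 i) (c 0 l), frameDeriv_mul (c 1 i) (c 1 l),
    frameDeriv_mul (c 2 i) (c 2 l)] at h
  simp only [Fin.sum_univ_three, frameMatrixDeriv]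
  linarith

theorem frameMatrixDeriv_zero {ψ : H3 → H3} (hψ : ContDiff ℝ ∞ ψ) (k i : Fin 3) (p : H3) :
    frameMatrixDeriv ψ p k 0 i = frameDeriv k (frameDeriv i (fun q => ψ q 0)) p := by
  simp only [frameMatrixDeriv, frameMatrix_zero hψ]

theorem frameMatrixDeriv_one {ψ : H3 → H3} (hψ : ContDiff ℝ ∞ ψ) (k i : Fin 3) (p : H3) :
    frameMatrixDeriv ψ p k 1 i = frameDeriv k (frameDeriv i (fun q => ψ q 1)) p := by
  simp only [frameMatrixDeriv, frameMatrix_one hψ]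

theorem frameMatrixDeriv_two {ψ : H3 → H3} (hψ : ContDiff ℝ ∞ ψ) (k i : Fin 3) (p : H3) :
    frameMatrixDeriv ψ p k 2 i = frameDeriv k (frameDeriv i (fun q => ψ q 2)) p
      + (1 / 2) * (ψ p 1 * frameDeriv k (frameDeriv i (fun q => ψ q 0)) p
          + frameMatrix ψ p 0 i * frameMatrix ψ p 1 k
        - (ψ p 0 * frameDeriv k (frameDeriv i (fun q => ψ q 1)) p
          + frameMatrix ψ p 1 i * frameMatrix ψ p 0 k)) := by
  have c := contDiff_coord hψ
  have d := fun j => contDiff_frameDeriv (c j) i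
  simp only [frameMatrixDeriv, frameMatrix_two hψ]
  rw [frameDeriv_add (d 2) (contDiff_const.mul (((c 1).mul (d 0)).sub ((c 0).mul (d 1)))),
    frameDeriv_const_mul (((c 1).mul (d 0)).sub ((c 0).mul (d 1))),
    frameDeriv_sub ((c 1).mul (d 0)) ((c 0).mul (d 1)),
    frameDeriv_mul (c 1) (d 0), frameDeriv_mul (c 0) (d 1)]
  simp only [frameMatrix_zero hψ, frameMatrix_one hψ]

/-- The structure constants of the frame: `[frame k, frame i] = bracketCoeff k i • frame 2`. -/
def bracketCoeff (k i : Fin 3) : ℝ :=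
  !![0, 1, 0; -1, 0, 0; 0, 0, 0] k i

theorem frameDeriv_comm {f : H3 → ℝ} (hf : ContDiff ℝ ∞ f) (k i : Fin 3) (p : H3) :
    frameDeriv k (frameDeriv i f) p - frameDeriv i (frameDeriv k f) p
      = bracketCoeff k i * frameDeriv 2 f p := by
  have h1 := frameDeriv_zero_one hf p
  have h2 := frameDeriv_zero_two hf p
  have h3 := frameDeriv_one_two hf p
  fin_cases k <;> fin_cases i <;> simp [bracketCoeff] <;> linarith

/-- The structure equations: `dψ [E_k, E_i] = [dψ E_k, dψ E_i]` in frame coordinates. -/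
theorem structure_equation {ψ : H3 → H3} (hψ : ContDiff ℝ ∞ ψ) (p : H3) (k i j : Fin 3) :
    frameMatrixDeriv ψ p k j i - frameMatrixDeriv ψ p i j k
      = bracketCoeff k i * frameMatrix ψ p j 2
        - (if j = 2 then frameMatrix ψ p 0 k * frameMatrix ψ p 1 i
          - frameMatrix ψ p 0 i * frameMatrix ψ p 1 k else 0) := by
  have c := fun j => frameDeriv_comm (contDiff_coord hψ j) k i p
  fin_cases j
  · simpa [frameMatrixDeriv_zero hψ, frameMatrix_zero hψ] using c 0
  · simpa [frameMatrixDeriv_one hψ, frameMatrix_one hψ] using c 1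
  · have h0 := c 0
    have h1 := c 1
    have h2 := c 2
    simp [frameMatrixDeriv_two hψ, frameMatrix_two hψ]
    linear_combination h2 + (1 / 2) * ψ p 1 * h0 - (1 / 2) * ψ p 0 * h1

/-! ### The connection form of an isometry -/

/-- The minors of the first two rows of an orthogonal matrix give its third row, up to the
determinant: the adjugate of `A` is `det A` times its transpose. -/
theorem orthogonal_minors {A : Matrix (Fin 3) (Fin 3) ℝ} (hA : A.transpose * A = 1) :
    A 0 0 * A 1 1 - A 0 1 * A 1 0 = A.det * A 2 2 ∧
    A 0 0 * A 1 2 - A 0 2 * A 1 0 = -(A.det * A 2 1) ∧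
    A 0 1 * A 1 2 - A 0 2 * A 1 1 = A.det * A 2 0 := by
  have h : A.adjugate = A.det • A.transpose := by
    have e : A.adjugate * (A * A.transpose) = A.det • A.transpose := by
      rw [← mul_assoc, Matrix.adjugate_mul, smul_mul_assoc, one_mul]
    rwa [mul_eq_one_comm.1 hA, mul_one] at e
  rw [Matrix.adjugate_fin_three] at h
  have h0 := congrFun (congrFun h 0) 2
  have h1 := congrFun (congrFun h 1) 2
  have h2 := congrFun (congrFun h 2) 2
  simp at h0 h1 h2
  refine ⟨?_, ?_, ?_⟩ <;> linarith

/-- The connection form `A⁻¹ dA` of the frame matrix, evaluated on `frame k`. -/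
def connectionForm (ψ : H3 → H3) (p : H3) (k m i : Fin 3) : ℝ :=
  ∑ j, frameMatrix ψ p j m * frameMatrixDeriv ψ p k j i

theorem frameMatrixDeriv_eq (ψ : Iso) (p : H3) (k j i : Fin 3) :
    frameMatrixDeriv ψ.1 p k j i
      = ∑ m, frameMatrix ψ.1 p j m * connectionForm ψ.1 p k m i := by
  have h : frameMatrix ψ.1 p * ((frameMatrix ψ.1 p).transpose
      * Matrix.of fun j i => frameMatrixDeriv ψ.1 p k j i)
      = Matrix.of fun j i => frameMatrixDeriv ψ.1 p k j i := by
    rw [← mul_assoc, mul_eq_one_comm.1 (frameMatrix_transpose_mul ψ p), one_mul]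
  exact (congrFun (congrFun h j) i).symm

/-- The structure equations expressed through the connection form, with the bottom row of the frame
matrix and the minors of its first two rows as coefficients. -/
theorem connectionForm_sub (ψ : Iso) (p : H3) (k i m : Fin 3) :
    connectionForm ψ.1 p k m i - connectionForm ψ.1 p i m k
      = bracketCoeff k i * (if m = 2 then 1 else 0)
        - frameMatrix ψ.1 p 2 m * (frameMatrix ψ.1 p 0 k * frameMatrix ψ.1 p 1 i
          - frameMatrix ψ.1 p 0 i * frameMatrix ψ.1 p 1 k) := by
  have h0 := structure_equation ψ.2.1 p k i 0
  have h1 := structure_equation ψ.2.1 p k i 1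
  have h2 := structure_equation ψ.2.1 p k i 2
  rw [← frameMatrix_orthonormal ψ p m 2]
  simp at h0 h1 h2
  simp only [connectionForm, Fin.sum_univ_three]
  linear_combination frameMatrix ψ.1 p 0 m * h0 + frameMatrix ψ.1 p 1 m * h1
    + frameMatrix ψ.1 p 2 m * h2

theorem connectionForm_skew (ψ : Iso) (p : H3) (k m i : Fin 3) :
    connectionForm ψ.1 p k m i = -connectionForm ψ.1 p k i m :=
  frameMatrixDeriv_skew ψ p k m i

/-- The Koszul formula: `connectionForm_sub` and `connectionForm_skew` determine the connection form
in terms of the determinant and the bottom row `(a, b, c)` of the frame matrix. -/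
theorem connectionForm_koszul (ψ : Iso) (p : H3) {d a b c : ℝ}
    (hd : (frameMatrix ψ.1 p).det = d) (ha : frameMatrix ψ.1 p 2 0 = a)
    (hb : frameMatrix ψ.1 p 2 1 = b) (hc : frameMatrix ψ.1 p 2 2 = c) :
    (connectionForm ψ.1 p 0 0 1 = -(d * c * a) ∧ connectionForm ψ.1 p 0 0 2 = d * b * a ∧
      connectionForm ψ.1 p 0 1 2 = -(1 - d * (-a ^ 2 + b ^ 2 + c ^ 2)) / 2) ∧
    (connectionForm ψ.1 p 1 0 1 = -(d * c * b) ∧ connectionForm ψ.1 p 1 1 2 = -(d * a * b) ∧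
      connectionForm ψ.1 p 1 0 2 = (1 - d * (a ^ 2 - b ^ 2 + c ^ 2)) / 2) ∧
    (connectionForm ψ.1 p 2 0 2 = d * b * c ∧ connectionForm ψ.1 p 2 1 2 = -(d * a * c) ∧
      connectionForm ψ.1 p 2 0 1 = (1 + d * (a ^ 2 + b ^ 2 - c ^ 2)) / 2) := by
  have s := connectionForm_skew ψ p
  have s00 := fun k => s k 0 0
  have s11 := fun k => s k 1 1
  have s22 := fun k => s k 2 2
  have s01 := fun k => s k 1 0
  have s02 := fun k => s k 2 0
  have s12 := fun k => s k 2 1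
  have t01 := connectionForm_sub ψ p 0 1
  have t02 := connectionForm_sub ψ p 0 2
  have t12 := connectionForm_sub ψ p 1 2
  obtain ⟨m2, m1, m0⟩ := orthogonal_minors (frameMatrix_transpose_mul ψ p)
  rw [hd] at m0 m1 m2
  rw [m2, hc] at t01
  rw [m1, hb] at t02
  rw [m0, ha] at t12
  have t010 := t01 0
  have t011 := t01 1
  have t012 := t01 2
  have t020 := t02 0
  have t021 := t02 1
  have t022 := t02 2
  have t120 := t12 0
  have t121 := t12 1
  have t122 := t12 2
  simp [bracketCoeff, ha, hb, hc] at t010 t011 t012 t020 t021 t022 t120 t121 t122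
  refine ⟨⟨?_, ?_, ?_⟩, ⟨?_, ?_, ?_⟩, ⟨?_, ?_, ?_⟩⟩ <;>
    linarith [s00 0, s00 1, s00 2, s11 0, s11 1, s11 2, s22 0, s22 1, s22 2, s01 0, s01 1, s01 2,
      s02 0, s02 1, s02 2, s12 0, s12 1, s12 2]

/-! ### Isometries preserve the vertical direction -/

theorem frameMatrix_row_two_unit (ψ : Iso) (p : H3) :
    frameMatrix ψ.1 p 2 0 ^ 2 + frameMatrix ψ.1 p 2 1 ^ 2 + frameMatrix ψ.1 p 2 2 ^ 2 = 1 := by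
  have o : frameMatrix ψ.1 p * (frameMatrix ψ.1 p).transpose = 1 :=
    mul_eq_one_comm.1 (frameMatrix_transpose_mul ψ p)
  have h := congrFun (congrFun o 2) 2
  simp [Matrix.mul_apply, Fin.sum_univ_three] at h
  linarith

/-- The bottom row of the frame matrix, that is the pullback under `ψ` of the contact form, solves a
linear first-order system with constant coefficients. -/
theorem frameMatrixDeriv_row_two (ψ : Iso) (p : H3) {t a b c : ℝ}
    (ht : (1 - (frameMatrix ψ.1 p).det) / 2 = t) (ha : frameMatrix ψ.1 p 2 0 = a)
    (hb : frameMatrix ψ.1 p 2 1 = b) (hc : frameMatrix ψ.1 p 2 2 = c) :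
    (frameMatrixDeriv ψ.1 p 0 2 0 = 0 ∧ frameMatrixDeriv ψ.1 p 0 2 1 = t * c ∧
      frameMatrixDeriv ψ.1 p 0 2 2 = -(t * b)) ∧
    (frameMatrixDeriv ψ.1 p 1 2 0 = -(t * c) ∧ frameMatrixDeriv ψ.1 p 1 2 1 = 0 ∧
      frameMatrixDeriv ψ.1 p 1 2 2 = t * a) ∧
    (frameMatrixDeriv ψ.1 p 2 2 0 = -((1 - t) * b) ∧
      frameMatrixDeriv ψ.1 p 2 2 1 = (1 - t) * a ∧ frameMatrixDeriv ψ.1 p 2 2 2 = 0) := by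
  have hu := frameMatrix_row_two_unit ψ p
  obtain ⟨⟨k1, k2, k3⟩, ⟨k4, k5, k6⟩, ⟨k7, k8, k9⟩⟩ :=
    connectionForm_koszul ψ p (d := 1 - 2 * t) (by linarith) ha hb hc
  have s := connectionForm_skew ψ p
  have s0 : ∀ k i, connectionForm ψ.1 p k i i = 0 := fun k i => by linarith [s k i i]
  simp only [frameMatrixDeriv_eq, Fin.sum_univ_three, s _ 1 0, s _ 2 0, s _ 2 1, s0, k1, k2, k3,
    k4, k5, k6, k7, k8, k9, ha, hb, hc]
  rw [ha, hb, hc] at hu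
  refine ⟨⟨?_, ?_, ?_⟩, ⟨?_, ?_, ?_⟩, ⟨?_, ?_, ?_⟩⟩
  · ring
  · linear_combination (-c * (1 - 2 * t) / 2) * hu
  · linear_combination (b * (1 - 2 * t) / 2) * hu
  · linear_combination (c * (1 - 2 * t) / 2) * hu
  · ring
  · linear_combination (-a * (1 - 2 * t) / 2) * hu
  · linear_combination (-b * (1 - 2 * t) / 2) * hu
  · linear_combination (a * (1 - 2 * t) / 2) * hu
  · ring

/-- `(1 - det A) / 2` for `A` the frame matrix of `ψ`, the coefficient in the linear system for the
bottom row. For an isometry it is `0` or `1`, according to the orientation. -/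
def orientationDefect (ψ : H3 → H3) (p : H3) : ℝ := (1 - (frameMatrix ψ p).det) / 2

theorem contDiff_orientationDefect (ψ : Iso) : ContDiff ℝ ∞ (orientationDefect ψ.1) := by
  have c := contDiff_frameMatrix ψ.2.1
  have h : orientationDefect ψ.1 = fun p => (1 - (frameMatrix ψ.1 p).det) / 2 := rfl
  simp only [h, Matrix.det_fin_three]
  fun_prop (disch := assumption)

/-- The orientation defect `t` satisfies `t ^ 2 = t`, so its derivatives vanish. -/
theorem frameDeriv_orientationDefect (ψ : Iso) (k : Fin 3) (p : H3) :
    frameDeriv k (orientationDefect ψ.1) p = 0 := by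
  have hs := contDiff_orientationDefect ψ
  have hd : ∀ q, orientationDefect ψ.1 q * orientationDefect ψ.1 q - orientationDefect ψ.1 q
      = 0 := by
    intro q
    have h := congrArg Matrix.det (frameMatrix_transpose_mul ψ q)
    rw [Matrix.det_mul, Matrix.det_transpose, Matrix.det_one] at h
    simp only [orientationDefect]
    linear_combination h / 4
  have h : frameDeriv k (fun q => orientationDefect ψ.1 q * orientationDefect ψ.1 q
      - orientationDefect ψ.1 q) p = 0 := by
    simp only [hd, frameDeriv_const]
  rw [frameDeriv_sub (hs.mul hs) hs, frameDeriv_mul hs hs] at h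
  have h2 : (2 * orientationDefect ψ.1 p - 1) * frameDeriv k (orientationDefect ψ.1) p = 0 := by
    linarith
  refine (mul_eq_zero.1 h2).resolve_left fun h3 => ?_
  have h4 : orientationDefect ψ.1 p = 1 / 2 := by linarith
  have h5 := hd p
  rw [h4] at h5
  norm_num at h5

/-- The integrability condition of the linear system for the bottom row forces it to be `± e₃`:
isometries preserve the vertical direction. -/
theorem frameMatrix_row_two (ψ : Iso) (p : H3) :
    frameMatrix ψ.1 p 2 0 = 0 ∧ frameMatrix ψ.1 p 2 1 = 0 := by
  have c := contDiff_frameMatrix ψ.2.1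
  have hs := contDiff_orientationDefect ψ
  have r := fun q => frameMatrixDeriv_row_two ψ q (t := orientationDefect ψ.1 q) rfl rfl rfl rfl
  set t := orientationDefect ψ.1
  -- the derivatives of the entries, as functions
  have e : ∀ k i, frameDeriv k (fun q => frameMatrix ψ.1 q 2 i)
      = fun q => frameMatrixDeriv ψ.1 q k 2 i := fun _ _ => rfl
  have g : ∀ k i q, frameDeriv k (fun x => t x * frameMatrix ψ.1 x 2 i) q
      = t q * frameMatrixDeriv ψ.1 q k 2 i := by
    intro k i q
    rw [frameDeriv_mul hs (c 2 i), frameDeriv_orientationDefect, mul_zero, add_zero]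
    rfl
  have g' : ∀ k i q, frameDeriv k (fun x => -(t x * frameMatrix ψ.1 x 2 i)) q
      = -(t q * frameMatrixDeriv ψ.1 q k 2 i) := by
    intro k i q
    have := frameDeriv_const_mul (hs.mul (c 2 i)) (-1) k q
    rw [g] at this
    simpa using this
  have h0 := frameDeriv_zero_one (c 2 0) p
  have h1 := frameDeriv_zero_one (c 2 1) p
  simp only [e, r] at h0 h1
  simp only [frameDeriv_const, g, g', r] at h0 h1
  -- `h0` and `h1` say that `t ^ 2 - t + 1` annihilates the first two entries
  have hpos : 0 < t p ^ 2 - t p + 1 := by nlinarith [sq_nonneg (t p - 1 / 2)]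
  constructor
  · refine (mul_eq_zero.1 ?_).resolve_left hpos.ne'
    linarith
  · refine (mul_eq_zero.1 ?_).resolve_left hpos.ne'
    linarith

theorem frameMatrix_two_two_sq (ψ : Iso) (p : H3) : frameMatrix ψ.1 p 2 2 ^ 2 = 1 := by
  have h := frameMatrix_row_two_unit ψ p
  rw [(frameMatrix_row_two ψ p).1, (frameMatrix_row_two ψ p).2] at h
  linarith

/-- Every isometry of `H₃` preserves the orientation: otherwise the derivative of the entry `(2, 1)`
along `frame 0` would be the entry `(2, 2) = ± 1`, but the entry `(2, 1)` vanishes identically. -/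
theorem det_frameMatrix (ψ : Iso) (p : H3) : (frameMatrix ψ.1 p).det = 1 := by
  have hb : ∀ q, frameMatrix ψ.1 q 2 1 = 0 := fun q => (frameMatrix_row_two ψ q).2
  obtain ⟨⟨-, r1, -⟩, -, -⟩ := frameMatrixDeriv_row_two ψ p rfl rfl rfl rfl
  simp only [frameMatrixDeriv, hb, frameDeriv_const] at r1
  have hc : frameMatrix ψ.1 p 2 2 ≠ 0 := by
    intro h
    have h2 := frameMatrix_two_two_sq ψ p
    rw [h] at h2
    norm_num at h2
  have := (mul_eq_zero.1 r1.symm).resolve_right hc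
  linarith

/-- For a bottom row `± e₃` and determinant `1`, the Koszul formula gives a vanishing connection
form. -/
theorem frameMatrixDeriv_eq_zero (ψ : Iso) (p : H3) (k j i : Fin 3) :
    frameMatrixDeriv ψ.1 p k j i = 0 := by
  have hc2 := frameMatrix_two_two_sq ψ p
  obtain ⟨⟨k1, k2, k3⟩, ⟨k4, k5, k6⟩, ⟨k7, k8, k9⟩⟩ :=
    connectionForm_koszul ψ p (det_frameMatrix ψ p)
      (frameMatrix_row_two ψ p).1 (frameMatrix_row_two ψ p).2 rfl
  have s := connectionForm_skew ψ p
  have s0 : ∀ k i, connectionForm ψ.1 p k i i = 0 := fun k i => by linarith [s k i i]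
  have z : ∀ m, connectionForm ψ.1 p k m i = 0 := by
    intro m
    fin_cases k <;> fin_cases m <;> fin_cases i <;>
      simp [s _ 1 0, s _ 2 0, s _ 2 1, s0, k1, k2, k3, k4, k5, k6, k7, k8, k9, hc2]
  simp [frameMatrixDeriv_eq, z]

theorem frameMatrix_const (ψ : Iso) (p : H3) : frameMatrix ψ.1 p = frameMatrix ψ.1 1 := by
  ext j i
  exact eq_of_frameDeriv_eq_zero (contDiff_frameMatrix ψ.2.1 j i)
    (fun k q => frameMatrixDeriv_eq_zero ψ q k j i) p 1

/-! ### The isometry group -/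

/-- An isometry is determined by its value and its differential at the identity: the frame matrix is
constant, so the coordinates of the two isometries have the same derivatives. The first two
coordinates are compared first, since they enter the bottom row of the frame matrix. -/
theorem Iso.ext_of_frameMatrix {ψ φ : Iso} (h1 : ψ.1 1 = φ.1 1)
    (hA : frameMatrix ψ.1 1 = frameMatrix φ.1 1) : ψ = φ := by
  have hA' : ∀ p, frameMatrix ψ.1 p = frameMatrix φ.1 p := fun p => by
    rw [frameMatrix_const ψ, hA, frameMatrix_const φ p]
  have cψ := contDiff_coord ψ.2.1
  have cφ := contDiff_coord φ.2.1
  have key : ∀ j, (∀ k p, frameDeriv k (fun q => ψ.1 q j) p = frameDeriv k (fun q => φ.1 q j) p) →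
      ∀ p, ψ.1 p j = φ.1 p j := by
    intro j h p
    have := eq_of_frameDeriv_eq_zero ((cψ j).sub (cφ j))
      (fun k q => by rw [frameDeriv_sub (cψ j) (cφ j), h, sub_self]) p 1
    rw [h1, sub_self] at this
    exact sub_eq_zero.1 this
  have e0 : ∀ k p, frameDeriv k (fun q => ψ.1 q 0) p = frameDeriv k (fun q => φ.1 q 0) p := by
    intro k p
    rw [← frameMatrix_zero ψ.2.1, hA', frameMatrix_zero φ.2.1]
  have e1 : ∀ k p, frameDeriv k (fun q => ψ.1 q 1) p = frameDeriv k (fun q => φ.1 q 1) p := by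
    intro k p
    rw [← frameMatrix_one ψ.2.1, hA', frameMatrix_one φ.2.1]
  have e2 : ∀ k p, frameDeriv k (fun q => ψ.1 q 2) p = frameDeriv k (fun q => φ.1 q 2) p := by
    intro k p
    have h := congrFun (congrFun (hA' p) 2) k
    rw [frameMatrix_two ψ.2.1, frameMatrix_two φ.2.1, e0, e1, key 0 e0, key 1 e1] at h
    linarith
  apply Subtype.ext
  ext1 p
  exact ext3 (key 0 e0 p) (key 1 e1 p) (key 2 e2 p)

theorem fderiv_leftTranslation_mul_orthogonalAut (a : H3) (B : O2) (p u : H3) :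
    fderiv ℝ (leftTranslation a * orthogonalAut B).1 p u = dL a (rot B.1 u) := by
  have h : HasFDerivAt (leftTranslation a * orthogonalAut B).1 ((dL a).comp (rotL B.1)) p :=
    (hasFDerivAt_mul_left a (rot B.1 p)).comp p (rotL B.1).hasFDerivAt
  rw [h.fderiv]
  rfl

theorem frameMatrix_leftTranslation_mul_orthogonalAut (a : H3) (B : O2) :
    frameMatrix (leftTranslation a * orthogonalAut B).1 1
      = !![B.1 0 0, B.1 0 1, 0; B.1 1 0, B.1 1 1, 0; 0, 0, B.1.det] := by
  have h1 : (leftTranslation a * orthogonalAut B).1 1 = a := by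
    change a * rot B.1 1 = a
    apply ext3 <;> simp [rot]
  ext j i
  have e : frameMatrix (leftTranslation a * orthogonalAut B).1 1 j i
      = rot B.1 (stdBasis i) j := by
    simp only [frameMatrix, Matrix.of_apply]
    rw [h1, fderiv_leftTranslation_mul_orthogonalAut, dL_inv_dL, frame, dL_one]
  rw [e]
  fin_cases j <;> fin_cases i <;> simp [stdBasis_zero, stdBasis_one, stdBasis_two, rot]

/-- `Iso(H₃) = H₃ ⋊ O(2)`. -/
theorem exists_leftTranslation_mul_orthogonalAut (ψ : Iso) :
    ∃ (a : H3) (B : O2), ψ = leftTranslation a * orthogonalAut B := by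
  set A := frameMatrix ψ.1 1 with hA
  have ho : A.transpose * A = 1 := frameMatrix_transpose_mul ψ 1
  have ho' : A * A.transpose = 1 := mul_eq_one_comm.1 ho
  obtain ⟨h20, h21⟩ : A 2 0 = 0 ∧ A 2 1 = 0 := frameMatrix_row_two ψ 1
  have h22 : A 2 2 ^ 2 = 1 := frameMatrix_two_two_sq ψ 1
  have hne : A 2 2 ≠ 0 := fun h => by norm_num [h] at h22
  have hdet : A 0 0 * A 1 1 - A 0 1 * A 1 0 = A 2 2 := by
    rw [(orthogonal_minors ho).1, det_frameMatrix, one_mul]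
  have h02 : A 0 2 = 0 := by
    have := congrFun (congrFun ho' 0) 2
    simpa [Matrix.mul_apply, Fin.sum_univ_three, h20, h21, hne] using this
  have h12 : A 1 2 = 0 := by
    have := congrFun (congrFun ho' 1) 2
    simpa [Matrix.mul_apply, Fin.sum_univ_three, h20, h21, hne] using this
  have hB : !![A 0 0, A 0 1; A 1 0, A 1 1] ∈ Matrix.orthogonalGroup (Fin 2) ℝ := by
    rw [Matrix.mem_orthogonalGroup_iff]
    ext i j
    have h00 := congrFun (congrFun ho' 0) 0
    have h01 := congrFun (congrFun ho' 0) 1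
    have h11 := congrFun (congrFun ho' 1) 1
    simp [Matrix.mul_apply, Fin.sum_univ_three, h02, h12] at h00 h01 h11
    fin_cases i <;> fin_cases j <;> simp [Matrix.mul_apply, Fin.sum_univ_two] <;> linarith
  refine ⟨ψ.1 1, ⟨_, hB⟩, Iso.ext_of_frameMatrix ?_ ?_⟩
  · change ψ.1 1 = ψ.1 1 * rot _ 1
    apply ext3 <;> simp [rot]
  · rw [frameMatrix_leftTranslation_mul_orthogonalAut, ← hA]
    ext i j
    fin_cases i <;> fin_cases j <;> simp [h20, h21, h02, h12, Matrix.det_fin_two, hdet]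

/-! ### Left-invariant Lorentz forces -/

theorem force_apply (U : Fin 2 → ℝ) (ρ : ℝ) (p u : H3) :
    (force U ρ).toFun p u = dL p (forceAtOne U ρ (dL p⁻¹ u)) := rfl

theorem force_apply_one (U : Fin 2 → ℝ) (ρ : ℝ) (u : H3) :
    (force U ρ).toFun 1 u = forceAtOne U ρ u := by
  rw [force_apply, inv_one, dL_one, dL_one]

theorem isLeftInvariant_force (U : Fin 2 → ℝ) (ρ : ℝ) : (force U ρ).IsLeftInvariant := by
  intro a p u
  rw [(hasFDerivAt_mul_left a p).fderiv, force_apply,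
    force_apply, mul_inv_rev, dL_mul p⁻¹ a⁻¹, dL_inv_dL, dL_mul]

theorem force_injective {U U' : Fin 2 → ℝ} {ρ ρ' : ℝ} (h : force U ρ = force U' ρ') :
    U = U' ∧ ρ = ρ' := by
  have e : ∀ u, forceAtOne U ρ u = forceAtOne U' ρ' u := fun u => by
    rw [← force_apply_one, h, force_apply_one]
  have h0 := congrFun (e (mk 1 0 0)) 1
  have h1 := congrFun (e (mk 0 0 1)) 0
  have h2 := congrFun (e (mk 0 0 1)) 1
  simp [forceAtOne_apply] at h0 h1 h2
  refine ⟨?_, h0⟩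
  ext i
  fin_cases i
  · exact h1
  · exact h2

theorem force_toFun_eq_zero_iff (U : Fin 2 → ℝ) (ρ : ℝ) :
    (force U ρ).toFun = 0 ↔ U = 0 ∧ ρ = 0 := by
  have h00 : (force 0 0).toFun = 0 := by
    funext p
    ext1 u
    have : forceAtOne 0 0 (dL p⁻¹ u) = 0 := by
      rw [forceAtOne_apply]
      apply ext3 <;> simp
    rw [force_apply, this, map_zero]
    rfl
  constructor
  · intro h
    exact force_injective (LorentzForce.ext (h.trans h00.symm))
  · rintro ⟨rfl, rfl⟩
    exact h00

theorem force_mem_nontrivialLeftInvariant {U : Fin 2 → ℝ} {ρ : ℝ} :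
    force U ρ ∈ nontrivialLeftInvariant ↔ ¬(U = 0 ∧ ρ = 0) := by
  rw [← force_toFun_eq_zero_iff]
  exact ⟨fun h => h.2, fun h => ⟨isLeftInvariant_force U ρ, h⟩⟩

/-- The form of a Lorentz force is alternating, so the force is skew-symmetric. -/
theorem LorentzForce.metric_skew (F : LorentzForce) (p u v : H3) :
    metric p (F.toFun p u) v = -metric p (F.toFun p v) u := by
  obtain ⟨Ω, -, hΩ, -⟩ := F.closed
  rw [← hΩ, ← hΩ]
  have h : Ω p (![u, v] ∘ Equiv.swap (0 : Fin 2) 1) = -Ω p ![u, v] :=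
    (Ω p).toAlternatingMap.map_swap ![u, v] (by simp)
  have e : (![u, v] ∘ Equiv.swap (0 : Fin 2) 1) = ![v, u] := by
    funext i
    fin_cases i <;> rfl
  rw [e] at h
  rw [h, neg_neg]

/-- Every left-invariant Lorentz force is one of the forces `F_{U,ρ}`: its value at the identity is
an arbitrary skew-symmetric endomorphism. -/
theorem LorentzForce.IsLeftInvariant.exists_eq_force {F : LorentzForce} (hF : F.IsLeftInvariant) :
    ∃ U ρ, F = force U ρ := by
  set T := F.toFun 1 with hT
  have sk : ∀ i l : Fin 3, T (stdBasis i) l = -T (stdBasis l) i := by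
    intro i l
    have h := F.metric_skew 1 (stdBasis i) (stdBasis l)
    rw [← hT, metric_eq, metric_eq] at h
    fin_cases i <;> fin_cases l <;>
      simpa [stdBasis_zero, stdBasis_one, stdBasis_two] using h
  have h00 : T (stdBasis 0) 0 = 0 := by linarith [sk 0 0]
  have h11 : T (stdBasis 1) 1 = 0 := by linarith [sk 1 1]
  have h22 : T (stdBasis 2) 2 = 0 := by linarith [sk 2 2]
  refine ⟨![T (stdBasis 0) 2, T (stdBasis 1) 2], T (stdBasis 0) 1, LorentzForce.ext ?_⟩
  have h1 : ∀ u, T u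
      = forceAtOne ![T (stdBasis 0) 2, T (stdBasis 1) 2] (T (stdBasis 0) 1) u := by
    intro u
    have e : u = u 0 • stdBasis 0 + u 1 • stdBasis 1 + u 2 • stdBasis 2 := by
      apply ext3 <;> simp [stdBasis_zero, stdBasis_one, stdBasis_two]
    have e' : T u = u 0 • T (stdBasis 0) + u 1 • T (stdBasis 1) + u 2 • T (stdBasis 2) := by
      conv_lhs => rw [e]
      simp only [map_add, map_smul]
    rw [e', forceAtOne_apply]
    apply ext3 <;> simp [h00, h11, h22, sk 1 0, sk 2 0, sk 2 1] <;> ring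
  funext p
  ext1 u
  have h := hF p 1 (dL p⁻¹ u)
  rw [(hasFDerivAt_mul_left p 1).fderiv, mul_one, dL_dL_inv,
    ← hT, h1] at h
  exact h.symm

/-! ### The action on left-invariant forces -/

theorem fderiv_symm_leftTranslation_mul_orthogonalAut (a : H3) (B : O2) (p u : H3) :
    fderiv ℝ (leftTranslation a * orthogonalAut B).1.symm p u
      = rot (B⁻¹ : O2).1 (dL a⁻¹ u) := by
  have h : HasFDerivAt (leftTranslation a * orthogonalAut B).1.symm
      ((rotL (B⁻¹ : O2).1).comp (dL a⁻¹)) p :=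
    (rotL (B⁻¹ : O2).1).hasFDerivAt.comp p (hasFDerivAt_mul_left a⁻¹ p)
  rw [h.fderiv]
  rfl

theorem rot_dL (B : O2) (p u : H3) : rot B.1 (dL p u) = dL (rot B.1 p) (rot B.1 u) := by
  apply ext3 <;> simp [rot, dL_apply, Matrix.det_fin_two]
  ring

theorem O2.det_mul_det (B : O2) : B.1.det * B.1.det = 1 := by
  have h := congrArg Matrix.det (Matrix.mem_orthogonalGroup_iff (Fin 2) ℝ |>.1 B.2)
  rwa [Matrix.det_mul, Matrix.det_transpose, Matrix.det_one] at h

/-- Conjugation by `B ∈ O(2)` on the endomorphisms of `𝔥₃` that define the forces `F_{U,ρ}`. -/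
theorem rot_forceAtOne (B : O2) (U : Fin 2 → ℝ) (ρ : ℝ) (u : H3) :
    rot B.1 (forceAtOne U ρ u)
      = forceAtOne (B.1.det • B.1.mulVec U) (B.1.det * ρ) (rot B.1 u) := by
  have h := Matrix.mem_orthogonalGroup_iff' (Fin 2) ℝ |>.1 B.2
  have h00 := congrFun (congrFun h 0) 0
  have h01 := congrFun (congrFun h 0) 1
  have h11 := congrFun (congrFun h 1) 1
  simp [Matrix.mul_apply, Fin.sum_univ_two] at h00 h01 h11
  have hd := Matrix.det_fin_two B.1
  have hdd := O2.det_mul_det B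
  have hV : ∀ i, (B.1.mulVec U) i = B.1 i 0 * U 0 + B.1 i 1 * U 1 := fun i => by
    simp only [Matrix.mulVec, dotProduct, Fin.sum_univ_two]
  -- `B` agrees up to the factor `det B` with its cofactor matrix
  have c00 : B.1 0 0 = B.1.det * B.1 1 1 := by
    rw [hd]
    linear_combination B.1 0 1 * h01 - B.1 0 0 * h11
  have c01 : B.1 0 1 = -(B.1.det * B.1 1 0) := by
    rw [hd]
    linear_combination B.1 0 0 * h01 - B.1 0 1 * h00
  have c10 : B.1 1 0 = -(B.1.det * B.1 0 1) := by
    rw [hd]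
    linear_combination B.1 1 1 * h01 - B.1 1 0 * h11
  have c11 : B.1 1 1 = B.1.det * B.1 0 0 := by
    rw [hd]
    linear_combination B.1 1 0 * h01 - B.1 1 1 * h00
  rw [forceAtOne_apply, forceAtOne_apply]
  apply ext3
  · simp only [rot, mk_zero, mk_one, mk_two, Pi.smul_apply, smul_eq_mul, hV]
    linear_combination -ρ * u 1 * c00 + ρ * u 0 * c01
      + (B.1 0 0 * U 0 + B.1 0 1 * U 1) * u 2 * hdd
  · simp only [rot, mk_zero, mk_one, mk_two, Pi.smul_apply, smul_eq_mul, hV]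
    linear_combination -ρ * u 1 * c10 + ρ * u 0 * c11
      + (B.1 1 0 * U 0 + B.1 1 1 * U 1) * u 2 * hdd
  · simp only [rot, mk_zero, mk_one, mk_two, Pi.smul_apply, smul_eq_mul, hV]
    linear_combination -B.1.det * (U 0 * u 0 * h00 + (U 0 * u 1 + U 1 * u 0) * h01
      + U 1 * u 1 * h11)

/-- The isometry `L_a ∘ B` and the scalar `r` send `F_{U,ρ}` to `F_{r det(B) B U, r det(B) ρ}`. -/
theorem smul_force (a : H3) (B : O2) (r : ℝˣ) (U : Fin 2 → ℝ) (ρ : ℝ) :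
    ((leftTranslation a * orthogonalAut B, r) : Iso × ℝˣ) • force U ρ
      = force ((r * B.1.det : ℝ) • B.1.mulVec U) (r * B.1.det * ρ) := by
  apply LorentzForce.ext
  funext p
  ext1 u
  rw [smul_def]
  have hB : ∀ w, rot B.1 (rot (B⁻¹ : O2).1 w) = w := fun w => (autO2 B).apply_symm_apply w
  set q := (leftTranslation a * orthogonalAut B).1.symm p with hq
  have hp : p = a * rot B.1 q := by
    have : (leftTranslation a * orthogonalAut B).1 q = p := Equiv.apply_symm_apply _ p
    exact this.symm
  have hr : ∀ w, forceAtOne ((r * B.1.det : ℝ) • B.1.mulVec U) (r * B.1.det * ρ) w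
      = (r : ℝ) • forceAtOne (B.1.det • B.1.mulVec U) (B.1.det * ρ) w := by
    intro w
    rw [forceAtOne_apply, forceAtOne_apply]
    apply ext3 <;> simp <;> ring
  have hi : rot B.1 (q⁻¹) = (rot B.1 q)⁻¹ := map_inv (autO2 B) q
  simp only [_root_.smul_apply, ContinuousLinearMap.comp_apply]
  rw [fderiv_leftTranslation_mul_orthogonalAut, fderiv_symm_leftTranslation_mul_orthogonalAut,
    force_apply, force_apply, rot_dL, rot_forceAtOne, rot_dL, hB, hi, hr, hp, mul_inv_rev, dL_mul,
    dL_mul, map_smul, map_smul]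

/-! ### Orbits -/

theorem smul_force_zero (g : Iso × ℝˣ) : g • force 0 0 = force 0 0 := by
  obtain ⟨ψ, r⟩ := g
  obtain ⟨a, B, rfl⟩ := exists_leftTranslation_mul_orthogonalAut ψ
  rw [smul_force, Matrix.mulVec_zero, smul_zero, mul_zero]

theorem smul_mem_nontrivialLeftInvariant (g : Iso × ℝˣ) {F : LorentzForce}
    (hF : F ∈ nontrivialLeftInvariant) : g • F ∈ nontrivialLeftInvariant := by
  obtain ⟨U, ρ, rfl⟩ := hF.1.exists_eq_force
  have key : g • force U ρ ≠ force 0 0 := by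
    rw [← smul_force_zero g]
    intro h
    exact force_mem_nontrivialLeftInvariant.1 hF (force_injective (smul_left_cancel g h))
  obtain ⟨ψ, r⟩ := g
  obtain ⟨a, B, rfl⟩ := exists_leftTranslation_mul_orthogonalAut ψ
  rw [smul_force] at key ⊢
  rw [force_mem_nontrivialLeftInvariant]
  rintro ⟨h1, h2⟩
  rw [h1, h2] at key
  exact key rfl

theorem mem_orbit_force_iff {U U' : Fin 2 → ℝ} {ρ ρ' : ℝ} :
    force U' ρ' ∈ MulAction.orbit (Iso × ℝˣ) (force U ρ) ↔
      ∃ (B : O2) (r : ℝˣ), (r * B.1.det : ℝ) • B.1.mulVec U = U' ∧ r * B.1.det * ρ = ρ' := by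
  constructor
  · rintro ⟨⟨ψ, r⟩, h⟩
    obtain ⟨a, B, rfl⟩ := exists_leftTranslation_mul_orthogonalAut ψ
    exact ⟨B, r, force_injective ((smul_force a B r U ρ).symm.trans h)⟩
  · rintro ⟨B, r, rfl, rfl⟩
    exact ⟨(leftTranslation 1 * orthogonalAut B, r), smul_force 1 B r U ρ⟩

theorem O2.rows (B : O2) : B.1 0 0 * B.1 0 0 + B.1 0 1 * B.1 0 1 = 1 ∧
    B.1 0 0 * B.1 1 0 + B.1 0 1 * B.1 1 1 = 0 ∧ B.1 1 0 * B.1 1 0 + B.1 1 1 * B.1 1 1 = 1 := by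
  have h := Matrix.mem_orthogonalGroup_iff (Fin 2) ℝ |>.1 B.2
  have h00 := congrFun (congrFun h 0) 0
  have h01 := congrFun (congrFun h 0) 1
  have h11 := congrFun (congrFun h 1) 1
  simp [Matrix.mul_apply, Fin.sum_univ_two] at h00 h01 h11
  exact ⟨h00, h01, h11⟩

theorem O2.column_zero (B : O2) : B.1 0 0 * B.1 0 0 + B.1 1 0 * B.1 1 0 = 1 := by
  have h := Matrix.mem_orthogonalGroup_iff' (Fin 2) ℝ |>.1 B.2
  have h00 := congrFun (congrFun h 0) 0
  simpa [Matrix.mul_apply, Fin.sum_univ_two] using h00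

theorem smul_mulVec_e1_iff (B : Matrix (Fin 2) (Fin 2) ℝ) (c : ℝ) :
    c • B.mulVec ![1, 0] = ![1, 0] ↔ c * B 0 0 = 1 ∧ c * B 1 0 = 0 := by
  have hV : ∀ i, (c • B.mulVec ![1, 0]) i = c * B i 0 := fun i => by
    fin_cases i <;> simp
  constructor
  · intro h
    exact ⟨by rw [← hV, h]; rfl, by rw [← hV, h]; rfl⟩
  · rintro ⟨h0, h1⟩
    funext i
    fin_cases i
    · exact (hV 0).trans h0
    · exact (hV 1).trans h1

theorem exists_orbit_eq {F : LorentzForce} (hF : F ∈ nontrivialLeftInvariant) :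
    (∃ ρ : ℝ, 0 ≤ ρ ∧ MulAction.orbit (Iso × ℝˣ) F =
        MulAction.orbit (Iso × ℝˣ) (force ![1, 0] ρ)) ∨
      MulAction.orbit (Iso × ℝˣ) F = MulAction.orbit (Iso × ℝˣ) (force 0 1) := by
  obtain ⟨U, ρ, rfl⟩ := hF.1.exists_eq_force
  have hne := force_mem_nontrivialLeftInvariant.1 hF
  by_cases hU : U = 0
  · right
    have hρ : ρ ≠ 0 := fun h => hne ⟨hU, h⟩
    rw [MulAction.orbit_eq_iff, mem_orbit_force_iff, hU]
    exact ⟨1, Units.mk0 ρ hρ, by simp, by simp⟩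
  · left
    -- the sign `s` makes the second parameter of the representative nonnegative
    obtain ⟨s, hs, hsρ⟩ : ∃ s : ℝ, s * s = 1 ∧ 0 ≤ s * ρ := by
      rcases le_total 0 ρ with h | h
      · exact ⟨1, by norm_num, by linarith⟩
      · exact ⟨-1, by norm_num, by linarith⟩
    set n := √(U 0 ^ 2 + U 1 ^ 2) with hn
    have hpos : 0 < U 0 ^ 2 + U 1 ^ 2 := by
      by_contra! h
      have h0 : U 0 = 0 := pow_eq_zero_iff two_ne_zero |>.1
        (by linarith [sq_nonneg (U 0), sq_nonneg (U 1)])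
      have h1 : U 1 = 0 := pow_eq_zero_iff two_ne_zero |>.1
        (by linarith [sq_nonneg (U 0), sq_nonneg (U 1)])
      refine hU (funext fun i => ?_)
      fin_cases i
      · exact h0
      · exact h1
    have hn0 : 0 < n := Real.sqrt_pos.2 hpos
    have hn2 : n * n = U 0 ^ 2 + U 1 ^ 2 := Real.mul_self_sqrt hpos.le
    have hs0 : s ≠ 0 := fun h => by norm_num [h] at hs
    -- the rotation taking `s n e₁` to `U`
    have hB : !![s * U 0 / n, -(s * U 1 / n); s * U 1 / n, s * U 0 / n]
        ∈ Matrix.orthogonalGroup (Fin 2) ℝ := by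
      have e : s * U 0 / n * (s * U 0 / n) + s * U 1 / n * (s * U 1 / n) = 1 := by
        field_simp
        linear_combination (U 0 ^ 2 + U 1 ^ 2) * hs - hn2
      rw [Matrix.mem_orthogonalGroup_iff]
      ext i j
      fin_cases i <;> fin_cases j <;> simp [Matrix.mul_apply, Fin.sum_univ_two] <;> linarith
    have hdet : (!![s * U 0 / n, -(s * U 1 / n); s * U 1 / n, s * U 0 / n]
        : Matrix (Fin 2) (Fin 2) ℝ).det = 1 := by
      rw [Matrix.det_fin_two_of]
      field_simp
      linear_combination (U 0 ^ 2 + U 1 ^ 2) * hs - hn2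
    refine ⟨s * ρ / n, div_nonneg hsρ hn0.le, ?_⟩
    rw [MulAction.orbit_eq_iff, mem_orbit_force_iff]
    refine ⟨⟨_, hB⟩, Units.mk0 (s * n) (mul_ne_zero hs0 hn0.ne'), ?_, ?_⟩
    · rw [hdet]
      funext i
      fin_cases i
      · simp
        field_simp
        linear_combination U 0 * hs
      · simp
        field_simp
        linear_combination U 1 * hs
    · rw [hdet]
      simp
      field_simp
      linear_combination ρ * hs

theorem orbit_force_e1_injective {ρ ρ' : ℝ} (hρ : 0 ≤ ρ) (hρ' : 0 ≤ ρ')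
    (h : MulAction.orbit (Iso × ℝˣ) (force ![1, 0] ρ) =
      MulAction.orbit (Iso × ℝˣ) (force ![1, 0] ρ')) : ρ = ρ' := by
  rw [MulAction.orbit_eq_iff, mem_orbit_force_iff] at h
  obtain ⟨B, r, h1, h2⟩ := h
  obtain ⟨h3, h4⟩ := (smul_mulVec_e1_iff _ _).1 h1
  -- the orthogonal matrix `B` preserves the norm of `e₁`
  have hc : (r * B.1.det : ℝ) ^ 2 = 1 := by
    linear_combination (r * B.1.det * B.1 0 0 + 1) * h3 + (r * B.1.det * B.1 1 0) * h4
      - (r * B.1.det : ℝ) ^ 2 * O2.column_zero B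
  have h5 : ρ ^ 2 = ρ' ^ 2 := by
    rw [← h2, mul_pow, hc, one_mul]
  exact (sq_eq_sq₀ hρ hρ').1 h5

theorem orbit_force_e1_ne (ρ : ℝ) : MulAction.orbit (Iso × ℝˣ) (force ![1, 0] ρ) ≠
    MulAction.orbit (Iso × ℝˣ) (force 0 1) := by
  intro h
  rw [MulAction.orbit_eq_iff, mem_orbit_force_iff] at h
  obtain ⟨B, r, h1, -⟩ := h
  rw [Matrix.mulVec_zero, smul_zero] at h1
  exact zero_ne_one (congrFun h1 0)

/-! ### The isotropy groups -/

theorem semidirectHom_mk (K : Subgroup (O2 × ℝˣ)) (a : H3) (k : K) :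
    semidirectHom K ⟨a, k⟩ = (leftTranslation a * orthogonalAut k.1.1, k.1.2) :=
  Prod.ext rfl (semidirectHom_apply K a 1 k).2

theorem semidirectHom_injective (K : Subgroup (O2 × ℝˣ)) :
    Function.Injective (semidirectHom K) := by
  rintro ⟨a, k⟩ ⟨b, l⟩ h
  have hp : ∀ p, a * rot k.1.1.1 p = b * rot l.1.1.1 p := fun p => by
    rw [← (semidirectHom_apply K a p k).1, h, (semidirectHom_apply K b p l).1]
  have hr : k.1.2 = l.1.2 := by
    rw [← (semidirectHom_apply K a 1 k).2, h, (semidirectHom_apply K b 1 l).2]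
  have h1 : ∀ B, rot B 1 = 1 := fun B => by
    apply ext3 <;> simp [rot]
  have hab : a = b := by
    have := hp 1
    rwa [h1, h1, mul_one, mul_one] at this
  have hB : ∀ p, rot k.1.1.1 p = rot l.1.1.1 p := fun p => by
    have := hp p
    rw [hab] at this
    exact mul_left_cancel this
  have hkl : k.1.1 = l.1.1 := by
    apply Subtype.ext
    ext i j
    have e0 := hB (mk 1 0 0)
    have e1 := hB (mk 0 1 0)
    have e00 := congrFun e0 0
    have e10 := congrFun e0 1
    have e01 := congrFun e1 0
    have e11 := congrFun e1 1
    simp [rot] at e00 e10 e01 e11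
    fin_cases i <;> fin_cases j <;> assumption
  have : k = l := Subtype.ext (Prod.ext hkl hr)
  rw [hab, this]

/-- The isotropy group of `F_{U,ρ}` contains all left translations, so it is determined by the
isotropy of `(U, ρ)` in `O(2) × ℝ*`. -/
theorem eqSemidirect_stabilizer_force {U : Fin 2 → ℝ} {ρ : ℝ} {K : Subgroup (O2 × ℝˣ)}
    (hK : ∀ (B : O2) (r : ℝˣ),
      (B, r) ∈ K ↔ (r * B.1.det : ℝ) • B.1.mulVec U = U ∧ r * B.1.det * ρ = ρ) :
    EqSemidirect (MulAction.stabilizer (Iso × ℝˣ) (force U ρ)) K := by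
  refine ⟨semidirectHom_injective K, ?_⟩
  ext g
  constructor
  · rintro ⟨⟨a, ⟨⟨B, r⟩, hk⟩⟩, rfl⟩
    rw [semidirectHom_mk, MulAction.mem_stabilizer_iff, smul_force, ((hK B r).1 hk).1,
      ((hK B r).1 hk).2]
  · intro hg
    obtain ⟨ψ, r⟩ := g
    obtain ⟨a, B, rfl⟩ := exists_leftTranslation_mul_orthogonalAut ψ
    rw [MulAction.mem_stabilizer_iff, smul_force] at hg
    exact ⟨⟨a, ⟨(B, r), (hK B r).2 (force_injective hg)⟩⟩, semidirectHom_mk K a _⟩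

/-- The stabilizer of the line `ℝ e₁` in `O(2)` consists of diagonal matrices. -/
theorem O2.diagonal_of_apply_one_zero {B : O2} (h : B.1 1 0 = 0) :
    B.1 0 1 = 0 ∧ (B.1 0 0 = 1 ∨ B.1 0 0 = -1) ∧ (B.1 1 1 = 1 ∨ B.1 1 1 = -1) := by
  obtain ⟨-, h2, h3⟩ := O2.rows B
  have h4 := O2.column_zero B
  rw [h] at h2 h3 h4
  have h5 : B.1 1 1 * B.1 1 1 = 1 := by linarith
  refine ⟨?_, mul_self_eq_one_iff.1 (by linarith), mul_self_eq_one_iff.1 h5⟩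
  linear_combination B.1 1 1 * h2 - B.1 0 1 * h5

theorem O2.ext_entries {A B : O2} (h00 : A.1 0 0 = B.1 0 0) (h01 : A.1 0 1 = B.1 0 1)
    (h10 : A.1 1 0 = B.1 1 0) (h11 : A.1 1 1 = B.1 1 1) : A = B := by
  apply Subtype.ext
  ext i j
  fin_cases i <;> fin_cases j <;> assumption

theorem mem_K₂_iff (B : O2) (r : ℝˣ) : (B, r) ∈ K₂ ↔
    (r * B.1.det : ℝ) * B.1 0 0 = 1 ∧ (r * B.1.det : ℝ) * B.1 1 0 = 0 := by
  have hm : (B, r) ∈ K₂ ↔ (B, r) = (1, 1) ∨ (B, r) = (-S, 1) ∨ (B, r) = (-1, -1) ∨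
    (B, r) = (S, -1) := Iff.rfl
  simp only [hm, Prod.mk.injEq]
  constructor
  · rintro (⟨rfl, rfl⟩ | ⟨rfl, rfl⟩ | ⟨rfl, rfl⟩ | ⟨rfl, rfl⟩) <;>
      simp [S, Matrix.det_fin_two, coe_neg_O2]
  · rintro ⟨h1, h2⟩
    have hc : (r * B.1.det : ℝ) ≠ 0 := fun h => by simp [h] at h1
    have h10 : B.1 1 0 = 0 := (mul_eq_zero.1 h2).resolve_left hc
    obtain ⟨h01, h00, h11⟩ := O2.diagonal_of_apply_one_zero h10
    rw [Matrix.det_fin_two, h10, h01] at h1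
    have hr : ∀ s : ℝˣ, (r : ℝ) = s → r = s := fun s h => Units.ext h
    rcases h00 with h00 | h00 <;> rcases h11 with h11 | h11 <;> rw [h00, h11] at h1
    · exact Or.inl ⟨O2.ext_entries (by simp [h00]) (by simp [h01]) (by simp [h10]) (by simp [h11]),
        hr 1 (by rw [Units.val_one]; linarith)⟩
    · exact Or.inr (Or.inr (Or.inr ⟨O2.ext_entries (by simp [h00, S]) (by simp [h01, S])
        (by simp [h10, S]) (by simp [h11, S]),
        hr (-1) (by rw [Units.val_neg, Units.val_one]; linarith)⟩))
    · exact Or.inr (Or.inl ⟨O2.ext_entries (by simp [h00, S, coe_neg_O2])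
        (by simp [h01, S, coe_neg_O2]) (by simp [h10, S, coe_neg_O2])
        (by simp [h11, S, coe_neg_O2]), hr 1 (by rw [Units.val_one]; linarith)⟩)
    · exact Or.inr (Or.inr (Or.inl ⟨O2.ext_entries (by simp [h00, coe_neg_O2])
        (by simp [h01, coe_neg_O2]) (by simp [h10, coe_neg_O2])
        (by simp [h11, coe_neg_O2]), hr (-1) (by rw [Units.val_neg, Units.val_one]; linarith)⟩))

theorem mem_K₁_iff (B : O2) (r : ℝˣ) : (B, r) ∈ K₁ ↔
    (B, r) ∈ K₂ ∧ (r * B.1.det : ℝ) = 1 := by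
  have hm : (B, r) ∈ K₂ ↔ (B, r) = (1, 1) ∨ (B, r) = (-S, 1) ∨ (B, r) = (-1, -1) ∨
    (B, r) = (S, -1) := Iff.rfl
  have hm1 : (B, r) ∈ K₁ ↔ (B, r) = (1, 1) ∨ (B, r) = (S, -1) := Iff.rfl
  simp only [hm, hm1, Prod.mk.injEq]
  constructor
  · rintro (⟨rfl, rfl⟩ | ⟨rfl, rfl⟩)
    · simp
    · simp [S, Matrix.det_fin_two]
  · rintro ⟨⟨rfl, rfl⟩ | ⟨rfl, rfl⟩ | ⟨rfl, rfl⟩ | ⟨rfl, rfl⟩, h⟩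
    · exact Or.inl ⟨rfl, rfl⟩
    · norm_num [S, Matrix.det_fin_two, coe_neg_O2] at h
    · norm_num [Matrix.det_fin_two, coe_neg_O2] at h
    · exact Or.inr ⟨rfl, rfl⟩

theorem mem_K₃_iff (B : O2) (r : ℝˣ) : (B, r) ∈ K₃ ↔ (r * B.1.det : ℝ) = 1 := by
  have hm : (B, r) ∈ K₃ ↔ (B.1.det = 1 ∧ r = 1) ∨ (B.1.det = -1 ∧ r = -1) := Iff.rfl
  rw [hm]
  constructor
  · rintro (⟨h, rfl⟩ | ⟨h, rfl⟩) <;> simp [h]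
  · intro h
    rcases mul_self_eq_one_iff.1 (O2.det_mul_det B) with h1 | h1
    · exact Or.inl ⟨h1, Units.ext (by rw [h1] at h; rw [Units.val_one]; linarith)⟩
    · exact Or.inr ⟨h1, Units.ext (by rw [h1] at h; rw [Units.val_neg, Units.val_one]; linarith)⟩

end H3

end

theorem mainTheorem4 :
    -- `Iso(H₃) × ℝ*` acts on the set of nontrivial left-invariant Lorentz forces
    (∀ g : H3.Iso × ℝˣ, ∀ F ∈ H3.nontrivialLeftInvariant, g • F ∈ H3.nontrivialLeftInvariant) ∧
    -- the representatives belong to this set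
    (∀ ρ : ℝ, 0 ≤ ρ → H3.force ![1, 0] ρ ∈ H3.nontrivialLeftInvariant) ∧
    H3.force 0 1 ∈ H3.nontrivialLeftInvariant ∧
    -- every orbit in this set is the orbit of one of the representatives
    (∀ F ∈ H3.nontrivialLeftInvariant,
      (∃ ρ : ℝ, 0 ≤ ρ ∧ MulAction.orbit (H3.Iso × ℝˣ) F =
        MulAction.orbit (H3.Iso × ℝˣ) (H3.force ![1, 0] ρ)) ∨
      MulAction.orbit (H3.Iso × ℝˣ) F = MulAction.orbit (H3.Iso × ℝˣ) (H3.force 0 1)) ∧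
    -- the orbits of the representatives are pairwise distinct
    (∀ ρ ρ' : ℝ, 0 ≤ ρ → 0 ≤ ρ' → ρ ≠ ρ' →
      MulAction.orbit (H3.Iso × ℝˣ) (H3.force ![1, 0] ρ) ≠
        MulAction.orbit (H3.Iso × ℝˣ) (H3.force ![1, 0] ρ')) ∧
    (∀ ρ : ℝ, 0 ≤ ρ →
      MulAction.orbit (H3.Iso × ℝˣ) (H3.force ![1, 0] ρ) ≠
        MulAction.orbit (H3.Iso × ℝˣ) (H3.force 0 1)) ∧
    -- the isotropy subgroups
    (∀ ρ : ℝ, 0 < ρ →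
      H3.EqSemidirect (MulAction.stabilizer (H3.Iso × ℝˣ) (H3.force ![1, 0] ρ)) H3.K₁) ∧
    H3.EqSemidirect (MulAction.stabilizer (H3.Iso × ℝˣ) (H3.force ![1, 0] 0)) H3.K₂ ∧
    H3.EqSemidirect (MulAction.stabilizer (H3.Iso × ℝˣ) (H3.force 0 1)) H3.K₃ := by
  refine ⟨fun g F hF => H3.smul_mem_nontrivialLeftInvariant g hF, fun ρ _ => ?_, ?_,
    fun F hF => H3.exists_orbit_eq hF, fun ρ ρ' hρ hρ' hne h =>
      hne (H3.orbit_force_e1_injective hρ hρ' h), fun ρ _ => H3.orbit_force_e1_ne ρ,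
    fun ρ hρ => H3.eqSemidirect_stabilizer_force fun B r => ?_,
    H3.eqSemidirect_stabilizer_force fun B r => ?_,
    H3.eqSemidirect_stabilizer_force fun B r => ?_⟩
  · rw [H3.force_mem_nontrivialLeftInvariant]
    exact fun h => one_ne_zero (congrFun h.1 0)
  · rw [H3.force_mem_nontrivialLeftInvariant]
    exact fun h => one_ne_zero h.2
  · rw [H3.mem_K₁_iff, H3.mem_K₂_iff, H3.smul_mulVec_e1_iff, mul_eq_right₀ hρ.ne']
  · rw [H3.mem_K₂_iff, H3.smul_mulVec_e1_iff, mul_zero, eq_self_iff_true, and_true]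
  · rw [H3.mem_K₃_iff, Matrix.mulVec_zero, smul_zero, mul_one, eq_self_iff_true, true_and]
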